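/- **LTL and the after-function.** Let $Ap$ be a set of atomic propositions. LTL formulas are in negation normal form, built from $\mathbf{tt},\mathbf{ff},a,\neg a$ ($a\in Ap$) with $\wedge,\vee,\mathbf X,\mathbf F,\mathbf G,\mathbf U,\mathbf W,\mathbf M,\mathbf R$ and interpreted as usual over $\omega$-words over $2^{Ap}$ ($\varphi\mathbf W\psi$ is $\mathbf G\varphi\vee\varphi\mathbf U\psi$; $\varphi\mathbf M\psi$ means that for some $k$, $\varphi$ holds at $k$ and $\psi$ holds at all $j\le k$; $\varphi\mathbf R\psi$ is $\mathbf G\psi\vee\varphi\mathbf M\psi$). The length $n$ of a formula is the number of nodes of its syntax tree. Write $\varphi\equiv_P\psi$ if the two formulas are propositionally equivalent when each maximal subformula that is a literal or starts with a temporal operator is read as a propositional variable; $[\varphi]_P$ is the class of $\varphi$. For a letter $\nu\subseteq Ap$, $\mathit{af}(\varphi,\nu)$ is defined by: $\mathit{af}(a,\nu)=\mathbf{tt}$ if $a\in\nu$ and $\mathbf{ff}$ otherwise, dually for $\neg a$; $\mathit{af}$ fixes $\mathbf{tt},\mathbf{ff}$ and commutes with $\wedge,\vee$; $\mathit{af}(\mathbf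 X\varphi,\nu)=\varphi$; $\mathit{af}(\mathbf F\varphi,\nu)=\mathit{af}(\varphi,\nu)\vee\mathbf F\varphi$; $\mathit{af}(\mathbf G\varphi,\nu)=\mathit{af}(\varphi,\nu)\wedge\mathbf G\varphi$; $\mathit{af}(\varphi\,\mathit{op}\,\psi,\nu)=\mathit{af}(\psi,\nu)\vee(\mathit{af}(\varphi,\nu)\wedge\varphi\,\mathit{op}\,\psi)$ for $\mathit{op}\in\{\mathbf U,\mathbf W\}$; $\mathit{af}(\varphi\,\mathit{op}\,\psi,\nu)=\mathit{af}(\psi,\nu)\wedge(\mathit{af}(\varphi,\nu)\vee\varphi\,\mathit{op}\,\psi)$ for $\mathit{op}\in\{\mathbf M,\mathbf R\}$. It extends to finite words letter by letter and to classes, and $\mathit{Reach}(\varphi)=\{[\mathit{af}(\varphi,u)]_P\mid u\in(2^{Ap})^*\}$. **Advice.** $\mu(\varphi)$ (resp. $\nu(\varphi)$) is the set of subformulas of $\varphi$ with root $\mathbf F,\mathbf U,\mathbf M$ (resp. $\mathbf G,\mathbf W,\mathbf R$). For $X\subseteq\mu(\varphi)$, $\psi[X]_\nu$ is obtained from $\psi$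 recursively, commuting with all operators except: $\mathbf F\chi$ becomes $\mathbf{tt}$ if $\mathbf F\chi\in X$ and $\mathbf{ff}$ otherwise; $\chi_1\mathbf U\chi_2$ becomes $\chi_1[X]_\nu\mathbf W\chi_2[X]_\nu$ if it is in $X$ and $\mathbf{ff}$ otherwise; $\chi_1\mathbf M\chi_2$ becomes $\chi_1[X]_\nu\mathbf R\chi_2[X]_\nu$ if it is in $X$ and $\mathbf{ff}$ otherwise. For $Y\subseteq\nu(\varphi)$, $\psi[Y]_\mu$ is obtained likewise: a subformula with root $\mathbf G,\mathbf W,\mathbf R$ becomes $\mathbf{tt}$ if it is in $Y$; otherwise $\mathbf G\chi$ becomes $\mathbf{ff}$, $\chi_1\mathbf W\chi_2$ becomes $\chi_1[Y]_\mu\mathbf U\chi_2[Y]_\mu$, and $\chi_1\mathbf R\chi_2$ becomes $\chi_1[Y]_\mu\mathbf M\chi_2[Y]_\mu$. **The automata.** For a formula $\psi$ with $[\psi]_P\in\mathit{Reach}(\varphi)$, $X\subseteq\mu(\varphi)$, $Y\subseteq\nu(\varphi)$, let $\mathcal D_{\psi,X,Y}$ be the intersection (product with a cyclic counter) of the following deterministic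 Büchi automata (DBAs), whose states are classes of formulas: for $\theta=\psi[X]_\nu$, and for $\theta=\mathbf G(\chi[X]_\nu)$ with $\chi\in Y$, the automaton with states $\mathit{Reach}(\theta)$, transition function $\mathit{af}$, initial state $\theta$, and accepting states all but $\mathbf{ff}$; for each $\chi\in X$, with $\theta=\mathbf F(\chi[Y]_\mu)$, the automaton with states $\mathit{Reach}(\theta)$, initial state $\theta$, the only accepting state $\mathbf{tt}$, and transition function $\mathit{af}$ except that every letter leads from $\mathbf{tt}$ back to $\theta$. The automaton $\mathcal A_\varphi$ is the disjoint union of the *initial component* $(\mathit{Reach}(\varphi),\mathit{af},[\varphi]_P)$, which has no accepting states, and the *accepting component*, the disjoint union of all $\mathcal D_{\psi,X,Y}$ with their accepting states; its initial state is $[\varphi]_P$, and for all $[\psi]_P\in\mathit{Reach}(\varphi)$, $X\subseteq\mu(\varphi)$, $Y\subseteq\nu(\varphi)$ there is an $\varepsilon$-transition from the state $[\psi]_P$ of the initial component to the initial state of $\mathcal D_{\psi,X,Y}$. (A run reads the whole word; it is accepting if some accepting state occurs infinitely often in it.) **Theorem.** There is a constant $C$ such that for every set $Ap$ and every formula $\varphi$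 over $Ap$, of length $n$: 1. For every formula $\psi$ with $[\psi]_P\in\mathit{Reach}(\varphi)$ and all $X\subseteq\mu(\varphi)$, $Y\subseteq\nu(\varphi)$, $\mathcal D_{\psi,X,Y}$ has at most $2^{2^{Cn}}$ states and accepts exactly the words $w$ with (1') $w\models\psi[X]_\nu$, (2') $w\models\mathbf{GF}(\chi[Y]_\mu)$ for all $\chi\in X$, (3') $w\models\mathbf G(\chi[X]_\nu)$ for all $\chi\in Y$. 2. $\mathcal A_\varphi$ is limit-deterministic: its states are partitioned into the initial and the accepting component; in the accepting component every state has, for every letter, exactly one successor, which lies in this component, and no $\varepsilon$-transitions; all accepting states lie in it. The initial component is deterministic too, except for the $\varepsilon$-transitions, which all lead into the accepting component. 3. $\mathcal A_\varphi$ accepts exactly the words $w$ with $w\models\varphi$. 4. The initial component has at most $2^{2^n}$ states, and $\mathcal A_\varphi$ has at most $2^{2^{Cn}}$ states in total. 5. Every accepting run of $\mathcal A_\varphi$ has exactly one nondeterministic step, an $\varepsilon$-transition from the initial to the accepting component; every other step reads a letter for which the current state has exactly one successor. 6. Removing the $\varepsilon$-transitions (a letter may be read after following $\varepsilon$-transitions)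 gives, on the same states, an $\varepsilon$-free limit-deterministic Büchi automaton for $L(\varphi)=\{w\mid w\models\varphi\}$: there is a set of states containing all accepting states in which every state has, for every letter, exactly one successor, again in the set. -/

import Mathlib

open Filter

universe u

/-! ## LTL in negation normal form -/

/-- LTL formulas in negation normal form over the atomic propositions `Ap`. -/
inductive LTL (Ap : Type u) : Type u
  | tt : LTL Ap
  | ff : LTL Ap
  | pos : Ap → LTL Ap
  | neg : Ap → LTL Ap
  | conj : LTL Ap → LTL Ap → LTL Ap
  | disj : LTL Ap → LTL Ap → LTL Ap
  | X : LTL Ap → LTL Ap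
  | F : LTL Ap → LTL Ap
  | G : LTL Ap → LTL Ap
  | U : LTL Ap → LTL Ap → LTL Ap
  | W : LTL Ap → LTL Ap → LTL Ap
  | M : LTL Ap → LTL Ap → LTL Ap
  | R : LTL Ap → LTL Ap → LTL Ap

/-- The infinite suffix of `w` that starts at position `k`. -/
def wordSuffix {α : Type u} (w : ℕ → α) (k : ℕ) : ℕ → α := fun n => w (k + n)

namespace LTL

variable {Ap : Type u}

/-- The length of a formula: the number of nodes of its syntax tree, whose leaves are the
constants and the literals. -/
def length : LTL Ap → ℕ
  | tt => 1
  | ff => 1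
  | pos _ => 1
  | neg _ => 1
  | conj φ ψ => φ.length + ψ.length + 1
  | disj φ ψ => φ.length + ψ.length + 1
  | X φ => φ.length + 1
  | F φ => φ.length + 1
  | G φ => φ.length + 1
  | U φ ψ => φ.length + ψ.length + 1
  | W φ ψ => φ.length + ψ.length + 1
  | M φ ψ => φ.length + ψ.length + 1
  | R φ ψ => φ.length + ψ.length + 1

/-- `Sat φ w` is `w ⊨ φ`. -/
def Sat : LTL Ap → (ℕ → Set Ap) → Prop
  | tt, _ => True
  | ff, _ => False
  | pos a, w => a ∈ w 0
  | neg a, w => a ∉ w 0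
  | conj φ ψ, w => φ.Sat w ∧ ψ.Sat w
  | disj φ ψ, w => φ.Sat w ∨ ψ.Sat w
  | X φ, w => φ.Sat (wordSuffix w 1)
  | F φ, w => ∃ k, φ.Sat (wordSuffix w k)
  | G φ, w => ∀ k, φ.Sat (wordSuffix w k)
  | U φ ψ, w => ∃ k, ψ.Sat (wordSuffix w k) ∧ ∀ j < k, φ.Sat (wordSuffix w j)
  | W φ ψ, w => (∀ k, φ.Sat (wordSuffix w k)) ∨
      ∃ k, ψ.Sat (wordSuffix w k) ∧ ∀ j < k, φ.Sat (wordSuffix w j)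
  | M φ ψ, w => ∃ k, φ.Sat (wordSuffix w k) ∧ ∀ j ≤ k, ψ.Sat (wordSuffix w j)
  | R φ ψ, w => (∀ k, ψ.Sat (wordSuffix w k)) ∨
      ∃ k, φ.Sat (wordSuffix w k) ∧ ∀ j ≤ k, ψ.Sat (wordSuffix w j)

/-- The language `L(φ)`. -/
def language (φ : LTL Ap) : Set (ℕ → Set Ap) := {w | φ.Sat w}

open Classical in
/-- The set of subformulas of a formula. -/
noncomputable def sf : LTL Ap → Finset (LTL Ap)
  | tt => {tt}
  | ff => {ff}
  | pos a => {pos a}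
  | neg a => {neg a}
  | conj φ ψ => insert (conj φ ψ) (φ.sf ∪ ψ.sf)
  | disj φ ψ => insert (disj φ ψ) (φ.sf ∪ ψ.sf)
  | X φ => insert (X φ) φ.sf
  | F φ => insert (F φ) φ.sf
  | G φ => insert (G φ) φ.sf
  | U φ ψ => insert (U φ ψ) (φ.sf ∪ ψ.sf)
  | W φ ψ => insert (W φ ψ) (φ.sf ∪ ψ.sf)
  | M φ ψ => insert (M φ ψ) (φ.sf ∪ ψ.sf)
  | R φ ψ => insert (R φ ψ) (φ.sf ∪ ψ.sf)

/-- The root is a least-fixed-point operator. -/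
def IsMu : LTL Ap → Prop
  | F _ => True
  | U _ _ => True
  | M _ _ => True
  | _ => False

/-- The root is a greatest-fixed-point operator. -/
def IsNu : LTL Ap → Prop
  | G _ => True
  | W _ _ => True
  | R _ _ => True
  | _ => False

open Classical in
/-- `μ(φ)`: the subformulas of `φ` of the form `F ψ`, `ψ₁ U ψ₂` or `ψ₁ M ψ₂`. -/
noncomputable def muSub (φ : LTL Ap) : Finset (LTL Ap) := φ.sf.filter IsMu

open Classical in
/-- `ν(φ)`: the subformulas of `φ` of the form `G ψ`, `ψ₁ W ψ₂` or `ψ₁ R ψ₂`. -/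
noncomputable def nuSub (φ : LTL Ap) : Finset (LTL Ap) := φ.sf.filter IsNu

open Classical in
/-- The formula `φ[S]_ν` for a set `S` of `μ`-formulas. -/
noncomputable def evalNu (S : Finset (LTL Ap)) : LTL Ap → LTL Ap
  | tt => tt
  | ff => ff
  | pos a => pos a
  | neg a => neg a
  | conj φ ψ => conj (φ.evalNu S) (ψ.evalNu S)
  | disj φ ψ => disj (φ.evalNu S) (ψ.evalNu S)
  | X φ => X (φ.evalNu S)
  | F φ => if F φ ∈ S then tt else ff
  | G φ => G (φ.evalNu S)
  | U φ ψ => if U φ ψ ∈ S then W (φ.evalNu S) (ψ.evalNu S) else ff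
  | W φ ψ => W (φ.evalNu S) (ψ.evalNu S)
  | M φ ψ => if M φ ψ ∈ S then R (φ.evalNu S) (ψ.evalNu S) else ff
  | R φ ψ => R (φ.evalNu S) (ψ.evalNu S)

open Classical in
/-- The formula `φ[S]_μ` for a set `S` of `ν`-formulas. -/
noncomputable def evalMu (S : Finset (LTL Ap)) : LTL Ap → LTL Ap
  | tt => tt
  | ff => ff
  | pos a => pos a
  | neg a => neg a
  | conj φ ψ => conj (φ.evalMu S) (ψ.evalMu S)
  | disj φ ψ => disj (φ.evalMu S) (ψ.evalMu S)
  | X φ => X (φ.evalMu S)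
  | F φ => F (φ.evalMu S)
  | G φ => if G φ ∈ S then tt else ff
  | U φ ψ => U (φ.evalMu S) (ψ.evalMu S)
  | W φ ψ => if W φ ψ ∈ S then tt else U (φ.evalMu S) (ψ.evalMu S)
  | M φ ψ => M (φ.evalMu S) (ψ.evalMu S)
  | R φ ψ => if R φ ψ ∈ S then tt else M (φ.evalMu S) (ψ.evalMu S)

open Classical in
/-- The formula `af(φ, ν)`, "`φ` after the letter `ν`". -/
noncomputable def af : LTL Ap → Set Ap → LTL Ap
  | tt, _ => tt
  | ff, _ => ff
  | pos a, ν => if a ∈ ν then tt else ff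
  | neg a, ν => if a ∈ ν then ff else tt
  | conj φ ψ, ν => conj (φ.af ν) (ψ.af ν)
  | disj φ ψ, ν => disj (φ.af ν) (ψ.af ν)
  | X φ, _ => φ
  | F φ, ν => disj (φ.af ν) (F φ)
  | G φ, ν => conj (φ.af ν) (G φ)
  | U φ ψ, ν => disj (ψ.af ν) (conj (φ.af ν) (U φ ψ))
  | W φ ψ, ν => disj (ψ.af ν) (conj (φ.af ν) (W φ ψ))
  | M φ ψ, ν => conj (ψ.af ν) (disj (φ.af ν) (M φ ψ))
  | R φ ψ, ν => conj (ψ.af ν) (disj (φ.af ν) (R φ ψ))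

/-- `af(φ, u)` for a finite word `u`. -/
noncomputable def afWord (φ : LTL Ap) (u : List (Set Ap)) : LTL Ap := u.foldl af φ

/-- The truth value of the propositional formula `φ_P`, in which every maximal proper subformula
`ψ` (a literal, or a formula with a temporal operator at the root) has been replaced by a
propositional variable `x_ψ`, under the assignment `x_ψ ↦ I ψ`. -/
def propEval (I : LTL Ap → Prop) : LTL Ap → Prop
  | tt => True
  | ff => False
  | conj φ ψ => φ.propEval I ∧ ψ.propEval I
  | disj φ ψ => φ.propEval I ∨ ψ.propEval I
  | pos a => I (pos a)
  | neg a => I (neg a)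
  | X φ => I (X φ)
  | F φ => I (F φ)
  | G φ => I (G φ)
  | U φ ψ => I (U φ ψ)
  | W φ ψ => I (W φ ψ)
  | M φ ψ => I (M φ ψ)
  | R φ ψ => I (R φ ψ)

/-- Propositional equivalence `φ ≡_P ψ`. -/
def PropEquiv (φ ψ : LTL Ap) : Prop := ∀ I : LTL Ap → Prop, φ.propEval I ↔ ψ.propEval I

theorem propEval_af (I : LTL Ap → Prop) (ν : Set Ap) (φ : LTL Ap) :
    (φ.af ν).propEval I ↔ φ.propEval (fun χ => (χ.af ν).propEval I) := by
  induction φ with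
  | conj φ ψ h₁ h₂ => simp only [af, propEval, h₁, h₂]
  | disj φ ψ h₁ h₂ => simp only [af, propEval, h₁, h₂]
  | _ => simp [af, propEval]

theorem propEval_evalNu (I : LTL Ap → Prop) (S : Finset (LTL Ap)) (φ : LTL Ap) :
    (φ.evalNu S).propEval I ↔ φ.propEval (fun χ => (χ.evalNu S).propEval I) := by
  induction φ with
  | conj φ ψ h₁ h₂ => simp only [evalNu, propEval, h₁, h₂]
  | disj φ ψ h₁ h₂ => simp only [evalNu, propEval, h₁, h₂]
  | _ => simp [evalNu, propEval]

instance propSetoid (Ap : Type u) : Setoid (LTL Ap) where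
  r := PropEquiv
  iseqv := ⟨fun _ _ => Iff.rfl, fun h I => (h I).symm, fun h h' I => (h I).trans (h' I)⟩

end LTL

/-- The classes `[φ]_P` of formulas modulo propositional equivalence. -/
def PropClass (Ap : Type u) : Type u := Quotient (LTL.propSetoid Ap)

namespace PropClass

variable {Ap : Type u}

/-- The class `[φ]_P`. -/
def mk (φ : LTL Ap) : PropClass Ap := Quotient.mk (LTL.propSetoid Ap) φ

/-- `af([φ]_P, ν) = [af(φ, ν)]_P`. -/
noncomputable def af (c : PropClass Ap) (ν : Set Ap) : PropClass Ap :=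
  Quotient.map (fun φ : LTL Ap => φ.af ν)
    (fun φ ψ h I => by
      rw [LTL.propEval_af, LTL.propEval_af]
      exact h _) c

/-- `[φ]_P[S]_ν = [φ[S]_ν]_P`. -/
noncomputable def evalNu (S : Finset (LTL Ap)) (c : PropClass Ap) : PropClass Ap :=
  Quotient.map (fun φ : LTL Ap => φ.evalNu S)
    (fun φ ψ h I => by
      rw [LTL.propEval_evalNu, LTL.propEval_evalNu]
      exact h _) c

/-- The classes `af(c, u)` for the finite words `u`. -/
def reach (c : PropClass Ap) : Set (PropClass Ap) :=
  {d | ∃ u : List (Set Ap), d = u.foldl PropClass.af c}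

theorem self_mem_reach (c : PropClass Ap) : c ∈ c.reach := ⟨[], rfl⟩

theorem af_mem_reach {c d : PropClass Ap} (h : d ∈ c.reach) (ν : Set Ap) :
    d.af ν ∈ c.reach := by
  obtain ⟨u, rfl⟩ := h
  exact ⟨u ++ [ν], by simp⟩

end PropClass

/-- `Reach(φ) = {[ψ]_P | ∃ u, ψ = af(φ, u)}`. -/
def LTL.Reach {Ap : Type u} (φ : LTL Ap) : Set (PropClass Ap) :=
  (PropClass.mk φ).reach

theorem LTL.mem_Reach {Ap : Type u} (φ : LTL Ap) (c : PropClass Ap) :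
    c ∈ φ.Reach ↔ ∃ u : List (Set Ap), c = PropClass.mk (φ.afWord u) := by
  have key : ∀ (u : List (Set Ap)) (ψ : LTL Ap),
      u.foldl PropClass.af (PropClass.mk ψ) = PropClass.mk (ψ.afWord u) := by
    intro u
    induction u with
    | nil => intro ψ; rfl
    | cons ν u ih => intro ψ; exact ih (ψ.af ν)
  simp only [LTL.Reach, PropClass.reach, Set.mem_ofPred_eq, key]

/-! ## Automata on infinite words -/

/-- The Büchi condition `inf(S)` for a sequence `r` of states: some state of `S` occurs infinitely
often in `r`. -/
def BuchiAccepting {Q : Type u} (S : Set Q) (r : ℕ → Q) : Prop :=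
  ∃ q ∈ S, ∃ᶠ n in atTop, r n = q

/-- Deterministic Büchi automata; finiteness of `Q` is stated separately. -/
structure DBA (α : Type u) where
  Q : Type u
  step : Q → α → Q
  init : Q
  acc : Set Q

namespace DBA

variable {α : Type u}

/-- The run of a deterministic automaton on a word. -/
def run (A : DBA α) (w : ℕ → α) : ℕ → A.Q
  | 0 => A.init
  | n + 1 => A.step (A.run w n) (w n)

/-- The language of a DBA. -/
def language (A : DBA α) : Set (ℕ → α) := {w | BuchiAccepting A.acc (A.run w)}

/-- A cyclic successor on a finite type. -/
noncomputable def cyclicSucc (ι : Type u) [Fintype ι] : ι → ι := fun i =>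
  (Fintype.equivFin ι).symm (finRotate (Fintype.card ι) (Fintype.equivFin ι i))

open Classical in
/-- The intersection of finitely many DBAs: their product, with a counter that says which automaton
has to visit an accepting state next, and that moves on cyclically when this happens. -/
noncomputable def iInter {ι : Type u} [Fintype ι] (i₀ : ι) (A : ι → DBA α) : DBA α where
  Q := (∀ i, (A i).Q) × ι
  step q a := (fun i => (A i).step (q.1 i) a,
    if q.1 q.2 ∈ (A q.2).acc then cyclicSucc ι q.2 else q.2)
  init := (fun i => (A i).init, i₀)
  acc := {q | q.2 = i₀ ∧ q.1 i₀ ∈ (A i₀).acc}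

variable {Ap : Type u}

/-- The automaton `(Reach(ψ), af, ψ)` for a (class of a) formula `ψ` of `νLTL`. The acceptance
condition `fin({ff})` is written as the Büchi condition `inf(Reach(ψ) \ {ff})`, which is the
same here because `ff` is a sink. -/
noncomputable def nuAut (c : PropClass Ap) : DBA (Set Ap) where
  Q := c.reach
  step s ν := ⟨s.1.af ν, PropClass.af_mem_reach s.2 ν⟩
  init := ⟨c, c.self_mem_reach⟩
  acc := {s | s.1 ≠ PropClass.mk LTL.ff}

open Classical in
/-- The automaton `(Reach(F ψ), af_{F ψ}, F ψ, inf({tt}))` for the formula `G F ψ`, where `ψ` is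
a formula of `μLTL`: it follows `af` and restarts in `F ψ` after it has visited `tt`. -/
noncomputable def gfAut (ψ : LTL Ap) : DBA (Set Ap) where
  Q := (PropClass.mk (LTL.F ψ)).reach
  step s ν := if s.1 = PropClass.mk LTL.tt then ⟨_, PropClass.self_mem_reach _⟩
    else ⟨s.1.af ν, PropClass.af_mem_reach s.2 ν⟩
  init := ⟨_, PropClass.self_mem_reach _⟩
  acc := {s | s.1 = PropClass.mk LTL.tt}

/-- The DBA `D_{ψ,X,Y}` for a class `c = [ψ]_P`: the intersection of the DBAs for `ψ[X]_ν`,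
for `G F (χ[Y]_μ)` with `χ ∈ X`, and for `G (χ[X]_ν)` with `χ ∈ Y`. -/
noncomputable def D (c : PropClass Ap) (X Y : Finset (LTL Ap)) : DBA (Set Ap) :=
  iInter (ι := Option ({χ // χ ∈ X} ⊕ {χ // χ ∈ Y})) none fun i =>
    match i with
    | none => nuAut (c.evalNu X)
    | some (Sum.inl χ) => gfAut (χ.1.evalMu Y)
    | some (Sum.inr χ) => nuAut (PropClass.mk (LTL.G (χ.1.evalNu X)))

end DBA

/-- Nondeterministic Büchi automata; finiteness of `Q` is stated separately. -/
structure NBA (α : Type u) where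
  Q : Type u
  Δ : Q → α → Set Q
  init : Set Q
  acc : Set Q

namespace NBA

variable {α : Type u}

/-- The language of an NBA. -/
def language (A : NBA α) : Set (ℕ → α) :=
  {w | ∃ r : ℕ → A.Q, r 0 ∈ A.init ∧ (∀ n, r (n + 1) ∈ A.Δ (r n) (w n)) ∧ BuchiAccepting A.acc r}

/-- Limit-determinism: there is a set `QD` of states, closed under the transitions and with
exactly one successor for every state and letter, that contains all accepting states. -/
def IsLimitDeterministic (A : NBA α) : Prop :=
  ∃ QD : Set A.Q, (∀ q ∈ QD, ∀ a, ∃ q' ∈ QD, A.Δ q a = {q'}) ∧ A.acc ⊆ QD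

end NBA

/-- Nondeterministic Büchi automata with ε-transitions. -/
structure EpsNBA (α : Type u) where
  Q : Type u
  Δ : Q → α → Set Q
  eps : Q → Set Q
  init : Set Q
  acc : Set Q

namespace EpsNBA

variable {α : Type u}

/-- A run on `w`: `r n` is the state after `n` steps and `p n` the number of letters that have been
read by then. Every step reads a letter or follows an ε-transition, and the whole word is read. -/
structure IsRun (A : EpsNBA α) (w : ℕ → α) (r : ℕ → A.Q) (p : ℕ → ℕ) : Prop where
  start : r 0 ∈ A.init
  pos_zero : p 0 = 0
  step : ∀ n, (p (n + 1) = p n + 1 ∧ r (n + 1) ∈ A.Δ (r n) (w (p n))) ∨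
    (p (n + 1) = p n ∧ r (n + 1) ∈ A.eps (r n))
  reads_all : ∀ m, ∃ n, m ≤ p n

/-- An accepting run. -/
def IsAcceptingRun (A : EpsNBA α) (w : ℕ → α) (r : ℕ → A.Q) (p : ℕ → ℕ) : Prop :=
  A.IsRun w r p ∧ BuchiAccepting A.acc r

/-- The language of a Büchi automaton with ε-transitions. -/
def language (A : EpsNBA α) : Set (ℕ → α) := {w | ∃ r p, A.IsAcceptingRun w r p}

/-- Step `n` of a run is deterministic if it reads a letter and the state that it
reaches is the only successor for this letter. (An ε-step is always nondeterministic.) -/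
def IsDetStep (A : EpsNBA α) (w : ℕ → α) (r : ℕ → A.Q) (p : ℕ → ℕ) (n : ℕ) : Prop :=
  p (n + 1) = p n + 1 ∧ A.Δ (r n) (w (p n)) = {r (n + 1)}

/-- Limit-determinism with respect to the partition of the states into `QDᶜ` and `QD`:
`QD` is a deterministic component without ε-transitions that contains all accepting states. -/
def IsLimitDeterministicWith (A : EpsNBA α) (QD : Set A.Q) : Prop :=
  (∀ q ∈ QD, ∀ a, ∃ q' ∈ QD, A.Δ q a = {q'}) ∧ (∀ q ∈ QD, A.eps q = ∅) ∧ A.acc ⊆ QD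

/-- Apart from ε-jumps out of it, the component `QN` is deterministic: it holds the only initial
state, every state and letter have exactly one successor, which is in `QN` again, and
ε-transitions leave `QN`. -/
def IsDeterministicUpToJumps (A : EpsNBA α) (QN : Set A.Q) : Prop :=
  (∃ q₀ ∈ QN, A.init = {q₀}) ∧ (∀ q ∈ QN, ∀ a, ∃ q' ∈ QN, A.Δ q a = {q'}) ∧
    ∀ q ∈ QN, A.eps q ⊆ QNᶜ

/-- The ε-free automaton with the same states: before it reads a letter, it may
follow ε-transitions. -/
def toNBA (A : EpsNBA α) : NBA α where
  Q := A.Q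
  Δ q a := {q'' | ∃ q', Relation.ReflTransGen (fun x y => y ∈ A.eps x) q q' ∧ q'' ∈ A.Δ q' a}
  init := A.init
  acc := A.acc

end EpsNBA

namespace LTL

variable {Ap : Type u}

/-- The triples `(ψ, X, Y)` with `ψ ∈ Reach(φ)`, `X ⊆ μ(φ)` and `Y ⊆ ν(φ)`. -/
def JumpIndex (φ : LTL Ap) : Type u :=
  φ.Reach × {X : Finset (LTL Ap) // X ⊆ φ.muSub} × {Y : Finset (LTL Ap) // Y ⊆ φ.nuSub}

/-- The DBA `D_{ψ,X,Y}` for a triple `(ψ, X, Y)`. -/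
noncomputable def jumpDBA (φ : LTL Ap) (i : φ.JumpIndex) : DBA (Set Ap) :=
  DBA.D i.1.1 i.2.1.1 i.2.2.1

/-- The limit-deterministic automaton for `φ`: the disjoint union of the initial component
`(Reach(φ), af, {φ})` and of all the DBAs `D_{ψ,X,Y}`, with an ε-transition from every state `ψ`
of the initial component to the initial state of `D_{ψ,X,Y}`, for all `X` and `Y`. -/
noncomputable def ldba (φ : LTL Ap) : EpsNBA (Set Ap) where
  Q := φ.Reach ⊕ (Σ i : φ.JumpIndex, (φ.jumpDBA i).Q)
  Δ q ν := match q with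
    | Sum.inl c => {Sum.inl ⟨c.1.af ν, PropClass.af_mem_reach c.2 ν⟩}
    | Sum.inr s => {Sum.inr ⟨s.1, (φ.jumpDBA s.1).step s.2 ν⟩}
  eps q := match q with
    | Sum.inl c => {q' | ∃ X Y, q' = Sum.inr ⟨(c, X, Y), (φ.jumpDBA (c, X, Y)).init⟩}
    | Sum.inr _ => ∅
  init := {Sum.inl ⟨PropClass.mk φ, PropClass.self_mem_reach _⟩}
  acc := {q | ∃ s : (Σ i : φ.JumpIndex, (φ.jumpDBA i).Q),
    q = Sum.inr s ∧ s.2 ∈ (φ.jumpDBA s.1).acc}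

/-- The states of the initial component. -/
def ldbaInitial (φ : LTL Ap) : Set φ.ldba.Q :=
  {q | ∃ c : φ.Reach, q = Sum.inl c}

/-- The states of the accepting component. -/
def ldbaAccepting (φ : LTL Ap) : Set φ.ldba.Q :=
  {q | ∃ s : (Σ i : φ.JumpIndex, (φ.jumpDBA i).Q), q = Sum.inr s}

end LTL

/-!
The proof has a logical and an automata-theoretic half.

*Logic.* Fix a word `w`. If `X` is the set of `μ`-subformulas that hold infinitely often and `Y` the
set of `ν`-subformulas that hold almost always, then from some position on what holds still holds
when `F`, `U`, `M` are replaced by constants and weak operators according to the advice `X`, or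
`G`, `W`, `R` by constants and strong operators according to the advice `Y` (`sat_evalNu_of_sat`,
`sat_evalMu_of_sat`). In the other direction arbitrary advice is truthful as soon as
it passes the tests `G F (χ[Y]_μ)` for `χ ∈ X` and `G (χ[X]_ν)` for `χ ∈ Y` (`advice_correct`):
these tests refer to each other, but the test for `χ` depends only on the advice about proper
subformulas of `χ`. Since `w ⊨ φ` iff the suffix after a prefix `u` satisfies `af(φ, u)` (`sat_afRun`), this gives
`sat_iff_exists_advice`: `w ⊨ φ` iff, at some position, `af(φ, u)[X]_ν` holds for some `X` and `Y`
that pass their tests.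

*Automata.* Each of these conditions is checked by a small deterministic automaton. A formula
without `F`, `U`, `M` is a safety property whose violation makes `af` propositionally
unsatisfiable after finitely many letters (`refuted_of_not_sat`), and a formula without `G`, `W`,
`R` is a co-safety property whose satisfaction makes `af` a tautology (`validated_of_sat`). Hence
`D_{ψ,X,Y}` accepts the right language (`mem_language_D`), and the automaton for `φ` guesses, with
its single jump, the position and the advice (`exists_jump_of_isAcceptingRun`). The size bounds hold
because `af` never leaves the positive Boolean combinations of a set of formulas that is closed
under subformulas, and `n` variables admit at most `2 ^ 2 ^ n` such combinations up to equivalence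
(`card_reach_le`).
-/

/-! ### Words and the after-function -/

section Words

variable {α : Type u}

theorem wordSuffix_zero (w : ℕ → α) : wordSuffix w 0 = w := by
  funext n; simp [wordSuffix]

theorem wordSuffix_wordSuffix (w : ℕ → α) (i j : ℕ) :
    wordSuffix (wordSuffix w i) j = wordSuffix w (i + j) := by
  funext n; simp [wordSuffix, add_assoc]

end Words

namespace LTL

variable {Ap : Type u}

/-- A word satisfies `φ` iff its tail satisfies `af(φ, ν)` for the first letter `ν`. -/
theorem sat_af (φ : LTL Ap) (w : ℕ → Set Ap) :
    (φ.af (w 0)).Sat (wordSuffix w 1) ↔ φ.Sat w := by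
  have hs : ∀ k, wordSuffix (wordSuffix w 1) k = wordSuffix w (k + 1) := fun k => by
    rw [wordSuffix_wordSuffix, add_comm]
  induction φ with
  | tt => rfl
  | ff => rfl
  | pos a => by_cases h : a ∈ w 0 <;> simp [af, Sat, h]
  | neg a => by_cases h : a ∈ w 0 <;> simp [af, Sat, h]
  | conj φ ψ h₁ h₂ => simp only [af, Sat, h₁, h₂]
  | disj φ ψ h₁ h₂ => simp only [af, Sat, h₁, h₂]
  | X φ _ => rfl
  | F φ h =>
    simp only [af, Sat, h, hs]
    constructor
    · rintro (h | ⟨k, h⟩)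
      exacts [⟨0, by rwa [wordSuffix_zero]⟩, ⟨k + 1, h⟩]
    · rintro ⟨_ | k, h⟩
      exacts [Or.inl (by rwa [wordSuffix_zero] at h), Or.inr ⟨k, h⟩]
  | G φ h =>
    simp only [af, Sat, h, hs]
    constructor
    · rintro ⟨h, h'⟩ (_ | k)
      exacts [by rwa [wordSuffix_zero], h' k]
    · intro h
      exact ⟨by simpa [wordSuffix_zero] using h 0, fun k => h _⟩
  | U φ ψ h₁ h₂ =>
    simp only [af, Sat, h₁, h₂, hs]
    constructor
    · rintro (h | ⟨h, k, hk, hj⟩)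
      · exact ⟨0, by rwa [wordSuffix_zero], by simp⟩
      · refine ⟨k + 1, hk, ?_⟩
        rintro (_ | j) hjk
        exacts [by rwa [wordSuffix_zero], hj j (by omega)]
    · rintro ⟨_ | k, hk, hj⟩
      · exact Or.inl (by rwa [wordSuffix_zero] at hk)
      · exact Or.inr ⟨by simpa [wordSuffix_zero] using hj 0 (by omega), k, hk,
          fun j hjk => hj (j + 1) (by omega)⟩
  | W φ ψ h₁ h₂ =>
    simp only [af, Sat, h₁, h₂, hs]
    constructor
    · rintro (h | ⟨h, hG | ⟨k, hk, hj⟩⟩)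
      · exact Or.inr ⟨0, by rwa [wordSuffix_zero], by simp⟩
      · left
        rintro (_ | k)
        exacts [by rwa [wordSuffix_zero], hG k]
      · refine Or.inr ⟨k + 1, hk, ?_⟩
        rintro (_ | j) hjk
        exacts [by rwa [wordSuffix_zero], hj j (by omega)]
    · rintro (hG | ⟨_ | k, hk, hj⟩)
      · exact Or.inr ⟨by simpa [wordSuffix_zero] using hG 0, Or.inl fun k => hG _⟩
      · exact Or.inl (by rwa [wordSuffix_zero] at hk)
      · exact Or.inr ⟨by simpa [wordSuffix_zero] using hj 0 (by omega), Or.inr ⟨k, hk,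
          fun j hjk => hj (j + 1) (by omega)⟩⟩
  | M φ ψ h₁ h₂ =>
    simp only [af, Sat, h₁, h₂, hs]
    constructor
    · rintro ⟨h, h' | ⟨k, hk, hj⟩⟩
      · refine ⟨0, by rwa [wordSuffix_zero], fun j hj => ?_⟩
        obtain rfl : j = 0 := by omega
        rwa [wordSuffix_zero]
      · refine ⟨k + 1, hk, ?_⟩
        rintro (_ | j) hjk
        exacts [by rwa [wordSuffix_zero], hj j (by omega)]
    · rintro ⟨k, hk, hj⟩
      refine ⟨by simpa [wordSuffix_zero] using hj 0 (by omega), ?_⟩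
      rcases k with _ | k
      · exact Or.inl (by rwa [wordSuffix_zero] at hk)
      · exact Or.inr ⟨k, hk, fun j hjk => hj (j + 1) (by omega)⟩
  | R φ ψ h₁ h₂ =>
    simp only [af, Sat, h₁, h₂, hs]
    constructor
    · rintro ⟨h, h' | hG | ⟨k, hk, hj⟩⟩
      · refine Or.inr ⟨0, by rwa [wordSuffix_zero], fun j hj => ?_⟩
        obtain rfl : j = 0 := by omega
        rwa [wordSuffix_zero]
      · left
        rintro (_ | k)
        exacts [by rwa [wordSuffix_zero], hG k]
      · refine Or.inr ⟨k + 1, hk, ?_⟩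
        rintro (_ | j) hjk
        exacts [by rwa [wordSuffix_zero], hj j (by omega)]
    · rintro (hG | ⟨k, hk, hj⟩)
      · exact ⟨by simpa [wordSuffix_zero] using hG 0, Or.inr (Or.inl fun k => hG _)⟩
      · refine ⟨by simpa [wordSuffix_zero] using hj 0 (by omega), ?_⟩
        rcases k with _ | k
        · exact Or.inl (by rwa [wordSuffix_zero] at hk)
        · exact Or.inr (Or.inr ⟨k, hk, fun j hjk => hj (j + 1) (by omega)⟩)

/-- `afRun φ w n` is `af(φ, u)` for the prefix `u` of length `n` of the infinite word `w`. -/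
noncomputable def afRun (φ : LTL Ap) (w : ℕ → Set Ap) : ℕ → LTL Ap
  | 0 => φ
  | n + 1 => (φ.afRun w n).af (w n)

theorem afRun_succ' (φ : LTL Ap) (w : ℕ → Set Ap) (n : ℕ) :
    φ.afRun w (n + 1) = (φ.af (w 0)).afRun (wordSuffix w 1) n := by
  induction n with
  | zero => rfl
  | succ n ih => rw [afRun, ih, afRun, wordSuffix, add_comm 1 n]

theorem afRun_conj (φ ψ : LTL Ap) (w : ℕ → Set Ap) (n : ℕ) :
    (conj φ ψ).afRun w n = conj (φ.afRun w n) (ψ.afRun w n) := by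
  induction n with
  | zero => rfl
  | succ n ih => rw [afRun, ih]; rfl

theorem afRun_disj (φ ψ : LTL Ap) (w : ℕ → Set Ap) (n : ℕ) :
    (disj φ ψ).afRun w n = disj (φ.afRun w n) (ψ.afRun w n) := by
  induction n with
  | zero => rfl
  | succ n ih => rw [afRun, ih]; rfl

theorem sat_afRun (φ : LTL Ap) (w : ℕ → Set Ap) (n : ℕ) :
    (φ.afRun w n).Sat (wordSuffix w n) ↔ φ.Sat w := by
  induction n with
  | zero => rw [wordSuffix_zero]; rfl
  | succ n ih =>
    rw [← ih, ← sat_af (φ.afRun w n), wordSuffix_wordSuffix]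
    rfl

/-- Satisfaction by a word factors through propositional evaluation. -/
theorem sat_iff_propEval (φ : LTL Ap) (w : ℕ → Set Ap) :
    φ.Sat w ↔ φ.propEval fun χ => χ.Sat w := by
  induction φ with
  | conj φ ψ h₁ h₂ => simp only [Sat, propEval, h₁, h₂]
  | disj φ ψ h₁ h₂ => simp only [Sat, propEval, h₁, h₂]
  | tt => simp [Sat, propEval]
  | ff => simp [Sat, propEval]
  | _ => simp only [propEval]

theorem sat_congr {φ ψ : LTL Ap} (h : PropClass.mk φ = PropClass.mk ψ) (w : ℕ → Set Ap) :
    φ.Sat w ↔ ψ.Sat w := by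
  rw [sat_iff_propEval, sat_iff_propEval ψ]
  exact (Quotient.exact h : PropEquiv φ ψ) _

theorem mk_eq_ff_iff (φ : LTL Ap) :
    PropClass.mk φ = PropClass.mk ff ↔ ∀ I, ¬ φ.propEval I :=
  ⟨fun h I => by simpa [propEval] using (Quotient.exact h : PropEquiv φ ff) I,
    fun h => Quotient.sound fun I => by simpa [propEval] using h I⟩

theorem mk_eq_tt_iff (φ : LTL Ap) :
    PropClass.mk φ = PropClass.mk tt ↔ ∀ I, φ.propEval I :=
  ⟨fun h I => by simpa [propEval] using (Quotient.exact h : PropEquiv φ tt) I,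
    fun h => Quotient.sound fun I => by simpa [propEval] using h I⟩

/-! ### Bad prefixes of safety formulas -/

/-- Some prefix of `w` turns `φ` into a propositionally unsatisfiable formula. -/
def Refuted (φ : LTL Ap) (w : ℕ → Set Ap) : Prop :=
  ∃ n, ∀ I, ¬ (φ.afRun w n).propEval I

theorem not_propEval_afRun_mono {φ : LTL Ap} {w : ℕ → Set Ap} {n m : ℕ} (hnm : n ≤ m)
    (h : ∀ I, ¬ (φ.afRun w n).propEval I) : ∀ I, ¬ (φ.afRun w m).propEval I := by
  induction m, hnm using Nat.le_induction with
  | base => exact h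
  | succ m _ ih => exact fun I hI => ih _ ((propEval_af I (w m) _).1 hI)

theorem refuted_af_iff {φ : LTL Ap} {w : ℕ → Set Ap} :
    Refuted (φ.af (w 0)) (wordSuffix w 1) ↔ Refuted φ w := by
  constructor
  · rintro ⟨n, h⟩
    exact ⟨n + 1, by rwa [afRun_succ']⟩
  · rintro ⟨n, h⟩
    exact ⟨n, by rw [← afRun_succ']; exact not_propEval_afRun_mono (Nat.le_succ n) h⟩

theorem Refuted.conj_left {φ ψ : LTL Ap} {w : ℕ → Set Ap} (h : Refuted φ w) :
    Refuted (conj φ ψ) w := by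
  obtain ⟨n, h⟩ := h
  exact ⟨n, fun I hI => h I (by rw [afRun_conj] at hI; exact hI.1)⟩

theorem Refuted.conj_right {φ ψ : LTL Ap} {w : ℕ → Set Ap} (h : Refuted ψ w) :
    Refuted (conj φ ψ) w := by
  obtain ⟨n, h⟩ := h
  exact ⟨n, fun I hI => h I (by rw [afRun_conj] at hI; exact hI.2)⟩

theorem Refuted.disj {φ ψ : LTL Ap} {w : ℕ → Set Ap} (h : Refuted φ w) (h' : Refuted ψ w) :
    Refuted (disj φ ψ) w := by
  obtain ⟨n, h⟩ := h
  obtain ⟨m, h'⟩ := h'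
  refine ⟨max n m, fun I hI => ?_⟩
  rw [afRun_disj] at hI
  exact hI.elim (not_propEval_afRun_mono (le_max_left n m) h I)
    (not_propEval_afRun_mono (le_max_right n m) h' I)

theorem Refuted.G {φ : LTL Ap} {w : ℕ → Set Ap} {k : ℕ} (h : Refuted φ (wordSuffix w k)) :
    Refuted (G φ) w := by
  induction k generalizing w with
  | zero =>
    rw [wordSuffix_zero] at h
    exact refuted_af_iff.1 (refuted_af_iff.2 h).conj_left
  | succ k ih =>
    refine refuted_af_iff.1 (Refuted.conj_right (ih ?_))
    rwa [wordSuffix_wordSuffix, add_comm]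

theorem Refuted.W {φ ψ : LTL Ap} {w : ℕ → Set Ap} {k : ℕ} (h : Refuted φ (wordSuffix w k))
    (h' : ∀ j ≤ k, Refuted ψ (wordSuffix w j)) : Refuted (W φ ψ) w := by
  induction k generalizing w with
  | zero =>
    have h'' := h' 0 le_rfl
    rw [wordSuffix_zero] at h h''
    exact refuted_af_iff.1 ((refuted_af_iff.2 h'').disj (refuted_af_iff.2 h).conj_left)
  | succ k ih =>
    have h'' := h' 0 (Nat.zero_le _)
    rw [wordSuffix_zero] at h''
    refine refuted_af_iff.1 ((refuted_af_iff.2 h'').disj (Refuted.conj_right (ih ?_ ?_)))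
    · rwa [wordSuffix_wordSuffix, add_comm]
    · intro j hj
      rw [wordSuffix_wordSuffix, add_comm]
      exact h' (j + 1) (by omega)

theorem Refuted.R {φ ψ : LTL Ap} {w : ℕ → Set Ap} {k : ℕ} (h : Refuted ψ (wordSuffix w k))
    (h' : ∀ j < k, Refuted φ (wordSuffix w j)) : Refuted (R φ ψ) w := by
  induction k generalizing w with
  | zero =>
    rw [wordSuffix_zero] at h
    exact refuted_af_iff.1 (refuted_af_iff.2 h).conj_left
  | succ k ih =>
    have h'' := h' 0 (Nat.succ_pos _)
    rw [wordSuffix_zero] at h''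
    refine refuted_af_iff.1 (Refuted.conj_right ((refuted_af_iff.2 h'').disj (ih ?_ ?_)))
    · rwa [wordSuffix_wordSuffix, add_comm]
    · intro j hj
      rw [wordSuffix_wordSuffix, add_comm]
      exact h' (j + 1) (by omega)

theorem self_mem_sf (φ : LTL Ap) : φ ∈ φ.sf := by
  cases φ <;> simp [sf]

/-- A formula without least-fixed-point operators is a safety property: a word that violates it
has a prefix after which the formula is propositionally false. -/
theorem refuted_of_not_sat {φ : LTL Ap} (hφ : ∀ χ ∈ φ.sf, ¬ χ.IsMu) {w : ℕ → Set Ap}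
    (h : ¬ φ.Sat w) : Refuted φ w := by
  induction φ generalizing w with
  | tt => exact absurd trivial h
  | ff => exact ⟨0, fun I => id⟩
  | pos a => exact ⟨1, fun I => by simp_all [afRun, af, propEval, Sat]⟩
  | neg a => exact ⟨1, fun I => by simp_all [afRun, af, propEval, Sat]⟩
  | conj φ ψ h₁ h₂ =>
    simp only [sf, Finset.mem_insert, Finset.mem_union, or_imp, forall_and] at hφ
    by_cases hs : φ.Sat w
    · exact (h₂ hφ.2.2 fun hs' => h ⟨hs, hs'⟩).conj_right
    · exact (h₁ hφ.2.1 hs).conj_left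
  | disj φ ψ h₁ h₂ =>
    simp only [sf, Finset.mem_insert, Finset.mem_union, or_imp, forall_and] at hφ
    exact (h₁ hφ.2.1 fun hs => h (Or.inl hs)).disj (h₂ hφ.2.2 fun hs => h (Or.inr hs))
  | X φ ih =>
    simp only [sf, Finset.mem_insert, forall_eq_or_imp] at hφ
    exact refuted_af_iff.1 (ih hφ.2 h)
  | G φ ih =>
    simp only [sf, Finset.mem_insert, forall_eq_or_imp] at hφ
    simp only [Sat, not_forall] at h
    obtain ⟨k, hk⟩ := h
    exact (ih hφ.2 hk).G
  | W φ ψ h₁ h₂ =>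
    simp only [sf, Finset.mem_insert, Finset.mem_union, or_imp, forall_and] at hφ
    simp only [Sat, not_or, not_forall] at h
    classical
    -- up to the first failure of `φ`, the formula `ψ` fails as well: otherwise `φ U ψ` holds
    obtain ⟨hG, hU⟩ := h
    have hlt : ∀ j < Nat.find hG, φ.Sat (wordSuffix w j) := fun j hj =>
      not_not.1 (Nat.find_min hG hj)
    exact (h₁ hφ.2.1 (Nat.find_spec hG)).W fun j hj =>
      h₂ hφ.2.2 fun hs => hU ⟨j, hs, fun i hi => hlt i (by omega)⟩
  | R φ ψ h₁ h₂ =>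
    simp only [sf, Finset.mem_insert, Finset.mem_union, or_imp, forall_and] at hφ
    simp only [Sat, not_or, not_forall] at h
    classical
    obtain ⟨hG, hM⟩ := h
    have hlt : ∀ j < Nat.find hG, ψ.Sat (wordSuffix w j) := fun j hj =>
      not_not.1 (Nat.find_min hG hj)
    exact (h₂ hφ.2.2 (Nat.find_spec hG)).R fun j hj =>
      h₁ hφ.2.1 fun hs => hM ⟨j, hs, fun i hi => hlt i (by omega)⟩
  | F φ => exact absurd trivial (hφ _ (self_mem_sf _))
  | U φ ψ => exact absurd trivial (hφ _ (self_mem_sf _))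
  | M φ ψ => exact absurd trivial (hφ _ (self_mem_sf _))

theorem sat_iff_forall_ne_ff {φ : LTL Ap} (hφ : ∀ χ ∈ φ.sf, ¬ χ.IsMu) (w : ℕ → Set Ap) :
    φ.Sat w ↔ ∀ n, PropClass.mk (φ.afRun w n) ≠ PropClass.mk ff := by
  constructor
  · intro h n hn
    exact (sat_congr hn _).1 ((sat_afRun φ w n).2 h)
  · intro h
    by_contra hs
    obtain ⟨n, hn⟩ := refuted_of_not_sat hφ hs
    exact h n ((mk_eq_ff_iff _).2 hn)

/-! ### Good prefixes of co-safety formulas -/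

/-- Some prefix of `w` turns `φ` into a propositional tautology. -/
def Validated (φ : LTL Ap) (w : ℕ → Set Ap) : Prop :=
  ∃ n, ∀ I, (φ.afRun w n).propEval I

theorem propEval_afRun_mono {φ : LTL Ap} {w : ℕ → Set Ap} {n m : ℕ} (hnm : n ≤ m)
    (h : ∀ I, (φ.afRun w n).propEval I) : ∀ I, (φ.afRun w m).propEval I := by
  induction m, hnm using Nat.le_induction with
  | base => exact h
  | succ m _ ih => exact fun I => (propEval_af I (w m) _).2 (ih _)

theorem validated_af_iff {φ : LTL Ap} {w : ℕ → Set Ap} :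
    Validated (φ.af (w 0)) (wordSuffix w 1) ↔ Validated φ w := by
  constructor
  · rintro ⟨n, h⟩
    exact ⟨n + 1, by rwa [afRun_succ']⟩
  · rintro ⟨n, h⟩
    exact ⟨n, by rw [← afRun_succ']; exact propEval_afRun_mono (Nat.le_succ n) h⟩

theorem Validated.disj_left {φ ψ : LTL Ap} {w : ℕ → Set Ap} (h : Validated φ w) :
    Validated (disj φ ψ) w := by
  obtain ⟨n, h⟩ := h
  exact ⟨n, fun I => by rw [afRun_disj]; exact Or.inl (h I)⟩

theorem Validated.disj_right {φ ψ : LTL Ap} {w : ℕ → Set Ap} (h : Validated ψ w) :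
    Validated (disj φ ψ) w := by
  obtain ⟨n, h⟩ := h
  exact ⟨n, fun I => by rw [afRun_disj]; exact Or.inr (h I)⟩

theorem Validated.conj {φ ψ : LTL Ap} {w : ℕ → Set Ap} (h : Validated φ w)
    (h' : Validated ψ w) : Validated (conj φ ψ) w := by
  obtain ⟨n, h⟩ := h
  obtain ⟨m, h'⟩ := h'
  refine ⟨max n m, fun I => ?_⟩
  rw [afRun_conj]
  exact ⟨propEval_afRun_mono (le_max_left n m) h I, propEval_afRun_mono (le_max_right n m) h' I⟩

theorem Validated.F {φ : LTL Ap} {w : ℕ → Set Ap} {k : ℕ} (h : Validated φ (wordSuffix w k)) :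
    Validated (F φ) w := by
  induction k generalizing w with
  | zero =>
    rw [wordSuffix_zero] at h
    exact validated_af_iff.1 (validated_af_iff.2 h).disj_left
  | succ k ih =>
    refine validated_af_iff.1 (Validated.disj_right (ih ?_))
    rwa [wordSuffix_wordSuffix, add_comm]

theorem Validated.U {φ ψ : LTL Ap} {w : ℕ → Set Ap} {k : ℕ} (h : Validated ψ (wordSuffix w k))
    (h' : ∀ j < k, Validated φ (wordSuffix w j)) : Validated (U φ ψ) w := by
  induction k generalizing w with
  | zero =>
    rw [wordSuffix_zero] at h
    exact validated_af_iff.1 (validated_af_iff.2 h).disj_left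
  | succ k ih =>
    have h'' := h' 0 (Nat.succ_pos _)
    rw [wordSuffix_zero] at h''
    refine validated_af_iff.1 (Validated.disj_right ((validated_af_iff.2 h'').conj (ih ?_ ?_)))
    · rwa [wordSuffix_wordSuffix, add_comm]
    · intro j hj
      rw [wordSuffix_wordSuffix, add_comm]
      exact h' (j + 1) (by omega)

theorem Validated.M {φ ψ : LTL Ap} {w : ℕ → Set Ap} {k : ℕ} (h : Validated φ (wordSuffix w k))
    (h' : ∀ j ≤ k, Validated ψ (wordSuffix w j)) : Validated (M φ ψ) w := by
  induction k generalizing w with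
  | zero =>
    have h'' := h' 0 le_rfl
    rw [wordSuffix_zero] at h h''
    exact validated_af_iff.1 ((validated_af_iff.2 h'').conj (validated_af_iff.2 h).disj_left)
  | succ k ih =>
    have h'' := h' 0 (Nat.zero_le _)
    rw [wordSuffix_zero] at h''
    refine validated_af_iff.1 ((validated_af_iff.2 h'').conj (Validated.disj_right (ih ?_ ?_)))
    · rwa [wordSuffix_wordSuffix, add_comm]
    · intro j hj
      rw [wordSuffix_wordSuffix, add_comm]
      exact h' (j + 1) (by omega)

/-- A formula without greatest-fixed-point operators is a co-safety property: a word that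
satisfies it has a prefix after which the formula is propositionally true. -/
theorem validated_of_sat {φ : LTL Ap} (hφ : ∀ χ ∈ φ.sf, ¬ χ.IsNu) {w : ℕ → Set Ap}
    (h : φ.Sat w) : Validated φ w := by
  induction φ generalizing w with
  | tt => exact ⟨0, fun I => trivial⟩
  | ff => exact absurd h id
  | pos a => exact ⟨1, fun I => by simp_all [afRun, af, propEval, Sat]⟩
  | neg a => exact ⟨1, fun I => by simp_all [afRun, af, propEval, Sat]⟩
  | conj φ ψ h₁ h₂ =>
    simp only [sf, Finset.mem_insert, Finset.mem_union, or_imp, forall_and] at hφ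
    exact (h₁ hφ.2.1 h.1).conj (h₂ hφ.2.2 h.2)
  | disj φ ψ h₁ h₂ =>
    simp only [sf, Finset.mem_insert, Finset.mem_union, or_imp, forall_and] at hφ
    exact h.elim (fun h => (h₁ hφ.2.1 h).disj_left) fun h => (h₂ hφ.2.2 h).disj_right
  | X φ ih =>
    simp only [sf, Finset.mem_insert, forall_eq_or_imp] at hφ
    exact validated_af_iff.1 (ih hφ.2 h)
  | F φ ih =>
    simp only [sf, Finset.mem_insert, forall_eq_or_imp] at hφ
    obtain ⟨k, hk⟩ := h
    exact (ih hφ.2 hk).F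
  | U φ ψ h₁ h₂ =>
    simp only [sf, Finset.mem_insert, Finset.mem_union, or_imp, forall_and] at hφ
    obtain ⟨k, hk, hj⟩ := h
    exact (h₂ hφ.2.2 hk).U fun j hjk => h₁ hφ.2.1 (hj j hjk)
  | M φ ψ h₁ h₂ =>
    simp only [sf, Finset.mem_insert, Finset.mem_union, or_imp, forall_and] at hφ
    obtain ⟨k, hk, hj⟩ := h
    exact (h₁ hφ.2.1 hk).M fun j hjk => h₂ hφ.2.2 (hj j hjk)
  | G φ => exact absurd trivial (hφ _ (self_mem_sf _))
  | W φ ψ => exact absurd trivial (hφ _ (self_mem_sf _))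
  | R φ ψ => exact absurd trivial (hφ _ (self_mem_sf _))

end LTL

namespace LTL

variable {Ap : Type u}

/-! ### Subformulas -/

theorem sf_subset {φ χ : LTL Ap} (h : χ ∈ φ.sf) : χ.sf ⊆ φ.sf := by
  classical
  induction φ with
  | tt | ff | pos | neg =>
    obtain rfl := Finset.mem_singleton.1 h
    exact subset_rfl
  | X φ ih | F φ ih | G φ ih =>
    rcases Finset.mem_insert.1 h with rfl | h
    · exact subset_rfl
    · exact (ih h).trans (Finset.subset_insert _ _)
  | conj φ ψ h₁ h₂ | disj φ ψ h₁ h₂ | U φ ψ h₁ h₂ | W φ ψ h₁ h₂ | M φ ψ h₁ h₂ | R φ ψ h₁ h₂ =>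
    rcases Finset.mem_insert.1 h with rfl | h
    · exact subset_rfl
    · refine Finset.Subset.trans ?_ (Finset.subset_insert _ _)
      rcases Finset.mem_union.1 h with h | h
      · exact (h₁ h).trans Finset.subset_union_left
      · exact (h₂ h).trans Finset.subset_union_right

theorem length_lt_of_mem_sf {φ χ : LTL Ap} (h : χ ∈ φ.sf) (hne : χ ≠ φ) :
    χ.length < φ.length := by
  classical
  have key : χ = φ ∨ χ.length < φ.length := by
    clear hne
    induction φ with
    | tt | ff | pos | neg => exact Or.inl (Finset.mem_singleton.1 h)
    | X φ ih | F φ ih | G φ ih =>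
      rcases Finset.mem_insert.1 h with h | h
      · exact Or.inl h
      · right
        simp only [length]
        rcases ih h with rfl | h <;> omega
    | conj φ ψ h₁ h₂ | disj φ ψ h₁ h₂ | U φ ψ h₁ h₂ | W φ ψ h₁ h₂ | M φ ψ h₁ h₂
    | R φ ψ h₁ h₂ =>
      rcases Finset.mem_insert.1 h with h | h
      · exact Or.inl h
      · right
        simp only [length]
        rcases Finset.mem_union.1 h with h | h
        · rcases h₁ h with rfl | h <;> omega
        · rcases h₂ h with rfl | h <;> omega
  exact key.resolve_left hne

theorem muSub_subset_sf (φ : LTL Ap) : φ.muSub ⊆ φ.sf := by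
  classical exact Finset.filter_subset _ _

theorem nuSub_subset_sf (φ : LTL Ap) : φ.nuSub ⊆ φ.sf := by
  classical exact Finset.filter_subset _ _

theorem mem_sf_of_mem_sf_af {φ χ : LTL Ap} {ν : Set Ap} (hχ : χ.IsMu)
    (h : χ ∈ (φ.af ν).sf) : χ ∈ φ.sf := by
  classical
  induction φ with
  | tt | ff => exact h
  | pos a | neg a =>
    simp only [af] at h
    split_ifs at h <;> (obtain rfl := Finset.mem_singleton.1 h; exact hχ.elim)
  | X φ _ => exact Finset.mem_insert_of_mem h
  | F φ ih | G φ ih =>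
    simp only [af, sf, Finset.mem_insert, Finset.mem_union] at h ⊢
    rcases h with rfl | h
    · exact hχ.elim
    · tauto
  | conj φ ψ h₁ h₂ | disj φ ψ h₁ h₂ =>
    simp only [af, sf, Finset.mem_insert, Finset.mem_union] at h ⊢
    rcases h with rfl | h
    · exact hχ.elim
    · tauto
  | U φ ψ h₁ h₂ | W φ ψ h₁ h₂ | M φ ψ h₁ h₂ | R φ ψ h₁ h₂ =>
    simp only [af, sf, Finset.mem_insert, Finset.mem_union] at h ⊢
    rcases h with rfl | h | rfl | h
    · exact hχ.elim
    · tauto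
    · exact hχ.elim
    · tauto

theorem mem_sf_of_mem_sf_afRun {φ χ : LTL Ap} {w : ℕ → Set Ap} {n : ℕ} (hχ : χ.IsMu)
    (h : χ ∈ (φ.afRun w n).sf) : χ ∈ φ.sf := by
  induction n with
  | zero => exact h
  | succ n ih => exact ih (mem_sf_of_mem_sf_af hχ h)

/-! ### Evaluating a formula under advice -/

theorem not_isMu_of_mem_sf_evalNu (S : Finset (LTL Ap)) (φ : LTL Ap) :
    ∀ χ ∈ (φ.evalNu S).sf, ¬ χ.IsMu := by
  induction φ with
  | tt | ff | pos | neg => simp [evalNu, sf, IsMu]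
  | F φ _ => simp only [evalNu]; split_ifs <;> simp [sf, IsMu]
  | X φ ih | G φ ih => simpa [evalNu, sf, IsMu] using ih
  | conj φ ψ h₁ h₂ | disj φ ψ h₁ h₂ | W φ ψ h₁ h₂ | R φ ψ h₁ h₂ =>
    simp only [evalNu, sf, Finset.mem_insert, Finset.mem_union]
    rintro χ (rfl | h | h)
    exacts [id, h₁ _ h, h₂ _ h]
  | U φ ψ h₁ h₂ | M φ ψ h₁ h₂ =>
    simp only [evalNu]
    split_ifs
    · simp only [sf, Finset.mem_insert, Finset.mem_union]
      rintro χ (rfl | h | h)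
      exacts [id, h₁ _ h, h₂ _ h]
    · simp [sf, IsMu]

theorem not_isNu_of_mem_sf_evalMu (S : Finset (LTL Ap)) (φ : LTL Ap) :
    ∀ χ ∈ (φ.evalMu S).sf, ¬ χ.IsNu := by
  induction φ with
  | tt | ff | pos | neg => simp [evalMu, sf, IsNu]
  | G φ _ => simp only [evalMu]; split_ifs <;> simp [sf, IsNu]
  | X φ ih | F φ ih => simpa [evalMu, sf, IsNu] using ih
  | conj φ ψ h₁ h₂ | disj φ ψ h₁ h₂ | U φ ψ h₁ h₂ | M φ ψ h₁ h₂ =>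
    simp only [evalMu, sf, Finset.mem_insert, Finset.mem_union]
    rintro χ (rfl | h | h)
    exacts [id, h₁ _ h, h₂ _ h]
  | W φ ψ h₁ h₂ | R φ ψ h₁ h₂ =>
    simp only [evalMu]
    split_ifs
    · simp [sf, IsNu]
    · simp only [sf, Finset.mem_insert, Finset.mem_union]
      rintro χ (rfl | h | h)
      exacts [id, h₁ _ h, h₂ _ h]

section Mono

variable {φ φ' ψ ψ' : LTL Ap} {w : ℕ → Set Ap}

theorem Sat.U_mono (h : (U φ ψ).Sat w) (hφ : ∀ k, φ.Sat (wordSuffix w k) → φ'.Sat (wordSuffix w k))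
    (hψ : ∀ k, ψ.Sat (wordSuffix w k) → ψ'.Sat (wordSuffix w k)) : (U φ' ψ').Sat w :=
  let ⟨k, hk, hj⟩ := h
  ⟨k, hψ k hk, fun j hjk => hφ j (hj j hjk)⟩

theorem Sat.W_mono (h : (W φ ψ).Sat w) (hφ : ∀ k, φ.Sat (wordSuffix w k) → φ'.Sat (wordSuffix w k))
    (hψ : ∀ k, ψ.Sat (wordSuffix w k) → ψ'.Sat (wordSuffix w k)) : (W φ' ψ').Sat w :=
  h.imp (fun h k => hφ k (h k)) fun h => Sat.U_mono (φ := φ) (ψ := ψ) h hφ hψ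

theorem Sat.M_mono (h : (M φ ψ).Sat w) (hφ : ∀ k, φ.Sat (wordSuffix w k) → φ'.Sat (wordSuffix w k))
    (hψ : ∀ k, ψ.Sat (wordSuffix w k) → ψ'.Sat (wordSuffix w k)) : (M φ' ψ').Sat w :=
  let ⟨k, hk, hj⟩ := h
  ⟨k, hφ k hk, fun j hjk => hψ j (hj j hjk)⟩

theorem Sat.R_mono (h : (R φ ψ).Sat w) (hφ : ∀ k, φ.Sat (wordSuffix w k) → φ'.Sat (wordSuffix w k))
    (hψ : ∀ k, ψ.Sat (wordSuffix w k) → ψ'.Sat (wordSuffix w k)) : (R φ' ψ').Sat w :=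
  h.imp (fun h k => hψ k (h k)) fun h => Sat.M_mono (φ := φ) (ψ := ψ) h hφ hψ

theorem Sat.G_wordSuffix (h : (G φ).Sat w) (k : ℕ) : (G φ).Sat (wordSuffix w k) := fun j => by
  rw [wordSuffix_wordSuffix]; exact h _

theorem Sat.F_of_wordSuffix {k : ℕ} (h : (F φ).Sat (wordSuffix w k)) : (F φ).Sat w := by
  obtain ⟨j, hj⟩ := h
  exact ⟨k + j, by rwa [wordSuffix_wordSuffix] at hj⟩

theorem sat_FG_wordSuffix_iff {k : ℕ} :
    (F (G φ)).Sat (wordSuffix w k) ↔ (F (G φ)).Sat w := by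
  refine ⟨Sat.F_of_wordSuffix, fun ⟨j, hj⟩ => ⟨j, ?_⟩⟩
  have := hj.G_wordSuffix k
  rwa [wordSuffix_wordSuffix, add_comm, ← wordSuffix_wordSuffix] at this

theorem Sat.exists_of_GF (h : (G (F φ)).Sat w) : (F φ).Sat w := by
  simpa [wordSuffix_zero] using h 0

end Mono

/-- Replacing least by greatest fixed points is sound for satisfaction as long as the advice `S`
contains every least-fixed-point subformula that holds at some position. -/
theorem sat_evalNu_of_sat {S : Finset (LTL Ap)} {φ : LTL Ap} {w : ℕ → Set Ap}
    (hS : ∀ χ ∈ φ.sf, χ.IsMu → (F χ).Sat w → χ ∈ S) (h : φ.Sat w) : (φ.evalNu S).Sat w := by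
  induction φ generalizing w with
  | tt | ff | pos | neg => exact h
  | conj φ ψ h₁ h₂ =>
    simp only [sf, Finset.mem_insert, Finset.mem_union, or_imp, forall_and] at hS
    exact ⟨h₁ hS.2.1 h.1, h₂ hS.2.2 h.2⟩
  | disj φ ψ h₁ h₂ =>
    simp only [sf, Finset.mem_insert, Finset.mem_union, or_imp, forall_and] at hS
    exact h.imp (h₁ hS.2.1) (h₂ hS.2.2)
  | X φ ih =>
    simp only [sf, Finset.mem_insert, or_imp, forall_and] at hS
    exact ih (fun χ hχ hμ hF => hS.2 χ hχ hμ hF.F_of_wordSuffix) h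
  | F φ _ =>
    have hmem := hS _ (self_mem_sf _) trivial ⟨0, by rwa [wordSuffix_zero]⟩
    simp only [evalNu, if_pos hmem]
    trivial
  | G φ ih =>
    simp only [sf, Finset.mem_insert, or_imp, forall_and] at hS
    exact fun k => ih (fun χ hχ hμ hF => hS.2 χ hχ hμ hF.F_of_wordSuffix) (h k)
  | U φ ψ h₁ h₂ =>
    have hmem := hS _ (self_mem_sf _) trivial ⟨0, by rwa [wordSuffix_zero]⟩
    simp only [sf, Finset.mem_insert, Finset.mem_union, or_imp, forall_and] at hS
    simp only [evalNu, if_pos hmem]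
    exact Sat.W_mono (φ := φ) (ψ := ψ) (Or.inr h)
      (fun k => h₁ fun χ hχ hμ hF => hS.2.1 χ hχ hμ hF.F_of_wordSuffix)
      (fun k => h₂ fun χ hχ hμ hF => hS.2.2 χ hχ hμ hF.F_of_wordSuffix)
  | W φ ψ h₁ h₂ =>
    simp only [sf, Finset.mem_insert, Finset.mem_union, or_imp, forall_and] at hS
    exact h.W_mono (fun k => h₁ fun χ hχ hμ hF => hS.2.1 χ hχ hμ hF.F_of_wordSuffix)
      (fun k => h₂ fun χ hχ hμ hF => hS.2.2 χ hχ hμ hF.F_of_wordSuffix)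
  | M φ ψ h₁ h₂ =>
    have hmem := hS _ (self_mem_sf _) trivial ⟨0, by rwa [wordSuffix_zero]⟩
    simp only [sf, Finset.mem_insert, Finset.mem_union, or_imp, forall_and] at hS
    simp only [evalNu, if_pos hmem]
    exact Sat.R_mono (φ := φ) (ψ := ψ) (Or.inr h)
      (fun k => h₁ fun χ hχ hμ hF => hS.2.1 χ hχ hμ hF.F_of_wordSuffix)
      (fun k => h₂ fun χ hχ hμ hF => hS.2.2 χ hχ hμ hF.F_of_wordSuffix)
  | R φ ψ h₁ h₂ =>
    simp only [sf, Finset.mem_insert, Finset.mem_union, or_imp, forall_and] at hS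
    exact h.R_mono (fun k => h₁ fun χ hχ hμ hF => hS.2.1 χ hχ hμ hF.F_of_wordSuffix)
      (fun k => h₂ fun χ hχ hμ hF => hS.2.2 χ hχ hμ hF.F_of_wordSuffix)

/-- Replacing least by greatest fixed points loses nothing if the advised least-fixed-point
subformulas hold infinitely often: each of them supplies the eventuality that `W` and `R` lack. -/
theorem sat_of_sat_evalNu {S : Finset (LTL Ap)} {φ : LTL Ap} {w : ℕ → Set Ap}
    (hS : ∀ χ ∈ φ.sf, χ ∈ S → (G (F χ)).Sat w) (h : (φ.evalNu S).Sat w) : φ.Sat w := by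
  induction φ generalizing w with
  | tt | ff | pos | neg => exact h
  | conj φ ψ h₁ h₂ =>
    simp only [sf, Finset.mem_insert, Finset.mem_union, or_imp, forall_and] at hS
    exact ⟨h₁ hS.2.1 h.1, h₂ hS.2.2 h.2⟩
  | disj φ ψ h₁ h₂ =>
    simp only [sf, Finset.mem_insert, Finset.mem_union, or_imp, forall_and] at hS
    exact h.imp (h₁ hS.2.1) (h₂ hS.2.2)
  | X φ ih =>
    simp only [sf, Finset.mem_insert, or_imp, forall_and] at hS
    exact ih (fun χ hχ hm => (hS.2 χ hχ hm).G_wordSuffix 1) h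
  | F φ _ =>
    simp only [evalNu] at h
    split_ifs at h with hmem
    · obtain ⟨k, hk⟩ := (hS _ (self_mem_sf _) hmem).exists_of_GF
      exact hk.F_of_wordSuffix
    · exact h.elim
  | G φ ih =>
    simp only [sf, Finset.mem_insert, or_imp, forall_and] at hS
    exact fun k => ih (fun χ hχ hm => (hS.2 χ hχ hm).G_wordSuffix k) (h k)
  | U φ ψ h₁ h₂ =>
    simp only [evalNu] at h
    split_ifs at h with hmem
    · obtain ⟨k, j, hj, -⟩ := (hS _ (self_mem_sf _) hmem).exists_of_GF
      rw [wordSuffix_wordSuffix] at hj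
      simp only [sf, Finset.mem_insert, Finset.mem_union, or_imp, forall_and] at hS
      have hW : (W φ ψ).Sat w := h.W_mono
        (fun k => h₁ fun χ hχ hm => (hS.2.1 χ hχ hm).G_wordSuffix k)
        (fun k => h₂ fun χ hχ hm => (hS.2.2 χ hχ hm).G_wordSuffix k)
      exact hW.elim (fun hG => ⟨k + j, hj, fun i _ => hG i⟩) id
    · exact h.elim
  | W φ ψ h₁ h₂ =>
    simp only [sf, Finset.mem_insert, Finset.mem_union, or_imp, forall_and] at hS
    exact Sat.W_mono h (fun k => h₁ fun χ hχ hm => (hS.2.1 χ hχ hm).G_wordSuffix k)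
      (fun k => h₂ fun χ hχ hm => (hS.2.2 χ hχ hm).G_wordSuffix k)
  | M φ ψ h₁ h₂ =>
    simp only [evalNu] at h
    split_ifs at h with hmem
    · obtain ⟨k, j, hj, -⟩ := (hS _ (self_mem_sf _) hmem).exists_of_GF
      rw [wordSuffix_wordSuffix] at hj
      simp only [sf, Finset.mem_insert, Finset.mem_union, or_imp, forall_and] at hS
      have hR : (R φ ψ).Sat w := h.R_mono
        (fun k => h₁ fun χ hχ hm => (hS.2.1 χ hχ hm).G_wordSuffix k)
        (fun k => h₂ fun χ hχ hm => (hS.2.2 χ hχ hm).G_wordSuffix k)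
      exact hR.elim (fun hG => ⟨k + j, hj, fun i _ => hG i⟩) id
    · exact h.elim
  | R φ ψ h₁ h₂ =>
    simp only [sf, Finset.mem_insert, Finset.mem_union, or_imp, forall_and] at hS
    exact Sat.R_mono h (fun k => h₁ fun χ hχ hm => (hS.2.1 χ hχ hm).G_wordSuffix k)
      (fun k => h₂ fun χ hχ hm => (hS.2.2 χ hχ hm).G_wordSuffix k)

/-- Replacing greatest by least fixed points is sound for satisfaction as long as the advice `S`
contains every greatest-fixed-point subformula that holds almost always: if `φ W ψ` holds without
holding almost always, then `φ` fails somewhere, so that `φ U ψ` holds. -/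
theorem sat_evalMu_of_sat {S : Finset (LTL Ap)} {φ : LTL Ap} {w : ℕ → Set Ap}
    (hS : ∀ χ ∈ φ.sf, χ.IsNu → (F (G χ)).Sat w → χ ∈ S) (h : φ.Sat w) :
    (φ.evalMu S).Sat w := by
  induction φ generalizing w with
  | tt | ff | pos | neg => exact h
  | conj φ ψ h₁ h₂ =>
    simp only [sf, Finset.mem_insert, Finset.mem_union, or_imp, forall_and] at hS
    exact ⟨h₁ hS.2.1 h.1, h₂ hS.2.2 h.2⟩
  | disj φ ψ h₁ h₂ =>
    simp only [sf, Finset.mem_insert, Finset.mem_union, or_imp, forall_and] at hS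
    exact h.imp (h₁ hS.2.1) (h₂ hS.2.2)
  | X φ ih =>
    simp only [sf, Finset.mem_insert, or_imp, forall_and] at hS
    exact ih (fun χ hχ hν hF => hS.2 χ hχ hν (sat_FG_wordSuffix_iff.1 hF)) h
  | F φ ih =>
    simp only [sf, Finset.mem_insert, or_imp, forall_and] at hS
    obtain ⟨k, hk⟩ := h
    exact ⟨k, ih (fun χ hχ hν hF => hS.2 χ hχ hν (sat_FG_wordSuffix_iff.1 hF)) hk⟩
  | G φ _ =>
    have hmem := hS _ (self_mem_sf _) trivial ⟨0, fun k => by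
      rw [wordSuffix_zero]; exact h.G_wordSuffix k⟩
    simp only [evalMu, if_pos hmem]
    trivial
  | U φ ψ h₁ h₂ =>
    simp only [sf, Finset.mem_insert, Finset.mem_union, or_imp, forall_and] at hS
    exact h.U_mono
      (fun k => h₁ fun χ hχ hν hF => hS.2.1 χ hχ hν (sat_FG_wordSuffix_iff.1 hF))
      (fun k => h₂ fun χ hχ hν hF => hS.2.2 χ hχ hν (sat_FG_wordSuffix_iff.1 hF))
  | W φ ψ h₁ h₂ =>
    simp only [evalMu]
    split_ifs with hmem
    · trivial
    · have hU : (U φ ψ).Sat w := h.resolve_left fun hG => hmem <|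
        hS _ (self_mem_sf _) trivial ⟨0, fun k => by
          rw [wordSuffix_zero]; exact Or.inl (Sat.G_wordSuffix (φ := φ) hG k)⟩
      simp only [sf, Finset.mem_insert, Finset.mem_union, or_imp, forall_and] at hS
      exact hU.U_mono
        (fun k => h₁ fun χ hχ hν hF => hS.2.1 χ hχ hν (sat_FG_wordSuffix_iff.1 hF))
        (fun k => h₂ fun χ hχ hν hF => hS.2.2 χ hχ hν (sat_FG_wordSuffix_iff.1 hF))
  | M φ ψ h₁ h₂ =>
    simp only [sf, Finset.mem_insert, Finset.mem_union, or_imp, forall_and] at hS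
    exact h.M_mono
      (fun k => h₁ fun χ hχ hν hF => hS.2.1 χ hχ hν (sat_FG_wordSuffix_iff.1 hF))
      (fun k => h₂ fun χ hχ hν hF => hS.2.2 χ hχ hν (sat_FG_wordSuffix_iff.1 hF))
  | R φ ψ h₁ h₂ =>
    simp only [evalMu]
    split_ifs with hmem
    · trivial
    · have hM : (M φ ψ).Sat w := h.resolve_left fun hG => hmem <|
        hS _ (self_mem_sf _) trivial ⟨0, fun k => by
          rw [wordSuffix_zero]; exact Or.inl (Sat.G_wordSuffix (φ := ψ) hG k)⟩
      simp only [sf, Finset.mem_insert, Finset.mem_union, or_imp, forall_and] at hS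
      exact hM.M_mono
        (fun k => h₁ fun χ hχ hν hF => hS.2.1 χ hχ hν (sat_FG_wordSuffix_iff.1 hF))
        (fun k => h₂ fun χ hχ hν hF => hS.2.2 χ hχ hν (sat_FG_wordSuffix_iff.1 hF))

/-- Replacing greatest by least fixed points loses nothing if the advised greatest-fixed-point
subformulas hold at every position. -/
theorem sat_of_sat_evalMu {S : Finset (LTL Ap)} {φ : LTL Ap} {w : ℕ → Set Ap}
    (hS : ∀ χ ∈ φ.sf, χ ∈ S → (G χ).Sat w) (h : (φ.evalMu S).Sat w) : φ.Sat w := by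
  induction φ generalizing w with
  | tt | ff | pos | neg => exact h
  | conj φ ψ h₁ h₂ =>
    simp only [sf, Finset.mem_insert, Finset.mem_union, or_imp, forall_and] at hS
    exact ⟨h₁ hS.2.1 h.1, h₂ hS.2.2 h.2⟩
  | disj φ ψ h₁ h₂ =>
    simp only [sf, Finset.mem_insert, Finset.mem_union, or_imp, forall_and] at hS
    exact h.imp (h₁ hS.2.1) (h₂ hS.2.2)
  | X φ ih =>
    simp only [sf, Finset.mem_insert, or_imp, forall_and] at hS
    exact ih (fun χ hχ hm => (hS.2 χ hχ hm).G_wordSuffix 1) h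
  | F φ ih =>
    simp only [sf, Finset.mem_insert, or_imp, forall_and] at hS
    obtain ⟨k, hk⟩ := h
    exact ⟨k, ih (fun χ hχ hm => (hS.2 χ hχ hm).G_wordSuffix k) hk⟩
  | G φ _ =>
    simp only [evalMu] at h
    split_ifs at h with hmem
    · simpa only [wordSuffix_zero] using hS _ (self_mem_sf _) hmem 0
    · exact h.elim
  | U φ ψ h₁ h₂ =>
    simp only [sf, Finset.mem_insert, Finset.mem_union, or_imp, forall_and] at hS
    exact Sat.U_mono h (fun k => h₁ fun χ hχ hm => (hS.2.1 χ hχ hm).G_wordSuffix k)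
      (fun k => h₂ fun χ hχ hm => (hS.2.2 χ hχ hm).G_wordSuffix k)
  | W φ ψ h₁ h₂ =>
    simp only [evalMu] at h
    split_ifs at h with hmem
    · simpa only [wordSuffix_zero] using hS _ (self_mem_sf _) hmem 0
    · simp only [sf, Finset.mem_insert, Finset.mem_union, or_imp, forall_and] at hS
      exact Or.inr (h.U_mono (fun k => h₁ fun χ hχ hm => (hS.2.1 χ hχ hm).G_wordSuffix k)
        (fun k => h₂ fun χ hχ hm => (hS.2.2 χ hχ hm).G_wordSuffix k))
  | M φ ψ h₁ h₂ =>
    simp only [sf, Finset.mem_insert, Finset.mem_union, or_imp, forall_and] at hS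
    exact Sat.M_mono h (fun k => h₁ fun χ hχ hm => (hS.2.1 χ hχ hm).G_wordSuffix k)
      (fun k => h₂ fun χ hχ hm => (hS.2.2 χ hχ hm).G_wordSuffix k)
  | R φ ψ h₁ h₂ =>
    simp only [evalMu] at h
    split_ifs at h with hmem
    · simpa only [wordSuffix_zero] using hS _ (self_mem_sf _) hmem 0
    · simp only [sf, Finset.mem_insert, Finset.mem_union, or_imp, forall_and] at hS
      exact Or.inr (h.M_mono (fun k => h₁ fun χ hχ hm => (hS.2.1 χ hχ hm).G_wordSuffix k)
        (fun k => h₂ fun χ hχ hm => (hS.2.2 χ hχ hm).G_wordSuffix k))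

/-! ### Guessing the advice -/

theorem IsMu.not_isNu {χ : LTL Ap} (h : χ.IsMu) : ¬ χ.IsNu := by
  cases χ <;> simp_all [IsMu, IsNu]

/-- Advice that passes its own tests is truthful. The tests for `X` and for `Y` refer to each
other, but the test for `χ` involves only the advice on proper subformulas of `χ`, so truth
propagates by induction on the length. -/
theorem advice_correct {X Y : Finset (LTL Ap)} {w : ℕ → Set Ap} (hX : ∀ χ ∈ X, χ.IsMu)
    (hY : ∀ χ ∈ Y, χ.IsNu) (hXw : ∀ χ ∈ X, (G (F (χ.evalMu Y))).Sat w)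
    (hYw : ∀ χ ∈ Y, (G (χ.evalNu X)).Sat w) (χ : LTL Ap) :
    (χ ∈ X → (G (F χ)).Sat w) ∧ (χ ∈ Y → (G χ).Sat w) := by
  induction hn : χ.length using Nat.strong_induction_on generalizing χ with
  | _ n ih =>
    subst hn
    constructor
    · intro hχ i
      obtain ⟨j, hj⟩ := hXw χ hχ i
      refine ⟨j, sat_of_sat_evalMu (fun ξ hξ hm => ?_) hj⟩
      have hne : ξ ≠ χ := fun h => (hX χ hχ).not_isNu (h ▸ hY ξ hm)
      exact (((ih _ (length_lt_of_mem_sf hξ hne) ξ rfl).2 hm).G_wordSuffix i).G_wordSuffix j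
    · intro hχ i
      refine sat_of_sat_evalNu (fun ξ hξ hm => ?_) (hYw χ hχ i)
      have hne : ξ ≠ χ := fun h => (hX ξ hm).not_isNu (h ▸ hY χ hχ)
      exact ((ih _ (length_lt_of_mem_sf hξ hne) ξ rfl).1 hm).G_wordSuffix i

theorem eventually_sat_GF (χ : LTL Ap) (w : ℕ → Set Ap) :
    ∀ᶠ i in atTop, (F χ).Sat (wordSuffix w i) → (G (F χ)).Sat w := by
  by_cases h : (G (F χ)).Sat w
  · exact Eventually.of_forall fun _ _ => h
  · simp only [Sat, not_forall, not_exists] at h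
    obtain ⟨k, hk⟩ := h
    filter_upwards [eventually_ge_atTop k] with i hi
    rintro ⟨j, hj⟩
    refine (hk (i - k + j) ?_).elim
    rw [wordSuffix_wordSuffix] at hj ⊢
    rwa [show k + (i - k + j) = i + j by omega]

theorem eventually_sat_G (χ : LTL Ap) (w : ℕ → Set Ap) :
    ∀ᶠ i in atTop, (F (G χ)).Sat w → (G χ).Sat (wordSuffix w i) := by
  by_cases h : (F (G χ)).Sat w
  · obtain ⟨k, hk⟩ := h
    filter_upwards [eventually_ge_atTop k] with i hi _
    have := hk.G_wordSuffix (i - k)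
    rwa [wordSuffix_wordSuffix, Nat.add_sub_cancel' hi] at this
  · exact Eventually.of_forall fun _ h' => absurd h' h

/-- A word satisfies `φ` iff, from some position on, a choice of advice passes the tests that the
automata `DBA.D` perform. For the existence of the advice, take the `μ`-subformulas that hold
infinitely often and the `ν`-subformulas that hold almost always, and a position from which on
the former are the only `μ`-subformulas to hold at all and the latter hold always. -/
theorem sat_iff_exists_advice (φ : LTL Ap) (w : ℕ → Set Ap) :
    φ.Sat w ↔ ∃ i, ∃ X ⊆ φ.muSub, ∃ Y ⊆ φ.nuSub,
      ((φ.afRun w i).evalNu X).Sat (wordSuffix w i) ∧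
      (∀ χ ∈ X, (G (F (χ.evalMu Y))).Sat (wordSuffix w i)) ∧
      (∀ χ ∈ Y, (G (χ.evalNu X)).Sat (wordSuffix w i)) := by
  classical
  constructor
  · intro h
    obtain ⟨i, hi⟩ := (((eventually_all_finset φ.muSub).2 fun χ _ => eventually_sat_GF χ w).and
      ((eventually_all_finset φ.nuSub).2 fun χ _ => eventually_sat_G χ w)).exists
    obtain ⟨hμ, hν⟩ := hi
    set X := φ.muSub.filter fun χ => (G (F χ)).Sat w with hX
    set Y := φ.nuSub.filter fun χ => (F (G χ)).Sat w with hY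
    have hXi : ∀ χ ∈ φ.sf, χ.IsMu → (F χ).Sat (wordSuffix w i) → χ ∈ X := fun χ hχ hm hF => by
      have hχ' : χ ∈ φ.muSub := Finset.mem_filter.2 ⟨hχ, hm⟩
      exact Finset.mem_filter.2 ⟨hχ', hμ χ hχ' hF⟩
    refine ⟨i, X, Finset.filter_subset _ _, Y, Finset.filter_subset _ _, ?_, ?_, ?_⟩
    · exact sat_evalNu_of_sat (fun χ hχ hm => hXi χ (mem_sf_of_mem_sf_afRun hm hχ) hm)
        ((sat_afRun φ w i).2 h)
    · intro χ hχ j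
      obtain ⟨hχφ, hGF⟩ := Finset.mem_filter.1 hχ
      obtain ⟨k, hk⟩ := hGF.G_wordSuffix i j
      refine ⟨k, sat_evalMu_of_sat (fun ξ hξ hn hFG => ?_) hk⟩
      rw [sat_FG_wordSuffix_iff, sat_FG_wordSuffix_iff, sat_FG_wordSuffix_iff] at hFG
      exact Finset.mem_filter.2
        ⟨Finset.mem_filter.2 ⟨sf_subset (muSub_subset_sf φ hχφ) hξ, hn⟩, hFG⟩
    · intro χ hχ j
      obtain ⟨hχφ, hFG⟩ := Finset.mem_filter.1 hχ
      exact sat_evalNu_of_sat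
        (fun ξ hξ hm hF => hXi ξ (sf_subset (nuSub_subset_sf φ hχφ) hξ) hm hF.F_of_wordSuffix)
        (hν χ hχφ hFG j)
  · rintro ⟨i, X, hX, Y, hY, h₁, h₂, h₃⟩
    refine (sat_afRun φ w i).1 (sat_of_sat_evalNu (fun χ _ hm => ?_) h₁)
    exact (advice_correct (fun χ hχ => (Finset.mem_filter.1 (hX hχ)).2)
      (fun χ hχ => (Finset.mem_filter.1 (hY hχ)).2) h₂ h₃ χ).1 hm

end LTL

/-! ### Büchi acceptance and intersections -/

theorem buchiAccepting_iff_frequently {Q : Type u} [Finite Q] (S : Set Q) (r : ℕ → Q) :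
    BuchiAccepting S r ↔ ∃ᶠ n in atTop, r n ∈ S := by
  constructor
  · rintro ⟨q, hq, h⟩
    exact h.mono fun n hn => hn ▸ hq
  · intro h
    by_contra hc
    simp only [BuchiAccepting, not_exists, not_and, not_frequently] at hc
    exact h (((eventually_all_finite S.toFinite).2 hc).mono fun n hn hm => hn _ hm rfl)

namespace DBA

variable {α : Type u}

theorem exists_iterate_finRotate {n : ℕ} (i j : Fin n) : ∃ k, (finRotate n)^[k] i = j := by
  rcases n with _ | n
  · exact i.elim0
  · refine ⟨n + 1 - i.val + j.val, ?_⟩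
    have key : ∀ k, (((finRotate (n + 1))^[k] i : Fin (n + 1)) : ℕ) = (i + k) % (n + 1) := by
      intro k
      induction k with
      | zero => simp [Nat.mod_eq_of_lt i.2]
      | succ k ih =>
        rw [Function.iterate_succ_apply', finRotate_apply, Fin.val_add, ih,
          Fin.val_one', ← Nat.add_mod, add_assoc]
    apply Fin.ext
    rw [key, show i.val + (n + 1 - i.val + j.val) = j.val + (n + 1) by omega,
      Nat.add_mod_right, Nat.mod_eq_of_lt j.2]

/-- The cyclic successor has a single orbit. -/
theorem exists_iterate_cyclicSucc {ι : Type u} [Fintype ι] (i j : ι) :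
    ∃ k, (cyclicSucc ι)^[k] i = j := by
  obtain ⟨k, hk⟩ := exists_iterate_finRotate (Fintype.equivFin ι i) (Fintype.equivFin ι j)
  refine ⟨k, ?_⟩
  have key : ∀ k, (cyclicSucc ι)^[k] i =
      (Fintype.equivFin ι).symm ((finRotate (Fintype.card ι))^[k] (Fintype.equivFin ι i)) := by
    intro k
    induction k with
    | zero => simp
    | succ k ih => simp [Function.iterate_succ_apply', ih, cyclicSucc]
  rw [key, hk, Equiv.symm_apply_apply]

variable {ι : Type u} [Fintype ι]

theorem iInter_run_fst (i₀ : ι) (A : ι → DBA α) (w : ℕ → α) (n : ℕ) (i : ι) :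
    ((iInter i₀ A).run w n).1 i = (A i).run w n := by
  induction n with
  | zero => rfl
  | succ n ih =>
    change (A i).step (((iInter i₀ A).run w n).1 i) (w n) = _
    rw [ih]; rfl

open Classical in
theorem iInter_run_snd_succ (i₀ : ι) (A : ι → DBA α) (w : ℕ → α) (n : ℕ) :
    ((iInter i₀ A).run w (n + 1)).2 =
      if (A ((iInter i₀ A).run w n).2).run w n ∈ (A ((iInter i₀ A).run w n).2).acc
      then cyclicSucc ι ((iInter i₀ A).run w n).2 else ((iInter i₀ A).run w n).2 := by
  rw [← iInter_run_fst i₀ A w n]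
  rfl

/-- A counter that stays at `i` until the event `P i` happens and then moves on cyclically is
released infinitely often from one given position iff every event happens infinitely often. -/
theorem frequently_counter_iff (i₀ : ι) (P : ι → ℕ → Prop) (c : ℕ → ι)
    (hmove : ∀ n, P (c n) n → c (n + 1) = cyclicSucc ι (c n))
    (hstay : ∀ n, ¬ P (c n) n → c (n + 1) = c n) :
    (∃ᶠ n in atTop, c n = i₀ ∧ P i₀ n) ↔ ∀ i, ∃ᶠ n in atTop, P i n := by
  -- at any time the counter is eventually released, or else remains constant
  have hwait : ∀ n, (∃ m ≥ n, c m = c n ∧ P (c n) m) ∨ ∀ m ≥ n, c m = c n := by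
    intro n
    by_contra hc
    push Not at hc
    obtain ⟨hc, m, hm, hne⟩ := hc
    refine hne ?_
    induction m, hm using Nat.le_induction with
    | base => rfl
    | succ m hm ih =>
      by_cases h : c m = c n
      · rw [hstay m (by rw [h]; exact hc m hm h), h]
      · exact absurd (ih h) h
  constructor
  · intro h i
    have hall : ∀ k, ∃ᶠ n in atTop,
        c n = (cyclicSucc ι)^[k] i₀ ∧ P ((cyclicSucc ι)^[k] i₀) n := by
      intro k
      induction k with
      | zero => exact h
      | succ k ih =>
        rw [Function.iterate_succ_apply']
        set j := (cyclicSucc ι)^[k] i₀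
        rw [frequently_atTop] at ih ⊢
        intro N
        obtain ⟨n, hn, hcn, hP⟩ := ih N
        have hc1 : c (n + 1) = cyclicSucc ι j := by
          rw [hmove n (by rwa [hcn]), hcn]
        rcases hwait (n + 1) with ⟨m, hm, hcm, hPm⟩ | hconst
        · rw [hc1] at hcm hPm
          exact ⟨m, by omega, hcm, hPm⟩
        · -- the counter does return to `j`, so that it can be constant only if there is one index
          obtain ⟨m, hm, hcm, hPm⟩ := ih (n + 1)
          have hj : j = cyclicSucc ι j := hcm.symm.trans ((hconst m hm).trans hc1)
          exact ⟨m, by omega, by rw [← hj]; exact hcm, by rw [← hj]; exact hPm⟩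
    obtain ⟨k, rfl⟩ := exists_iterate_cyclicSucc i₀ i
    exact (hall k).mono fun n hn => hn.2
  · intro h
    have hrel : ∀ n, ∃ m ≥ n, c m = c n ∧ P (c n) m := fun n =>
      (hwait n).elim id fun hconst => by
        obtain ⟨m, hm, hP⟩ := frequently_atTop.1 (h (c n)) n
        exact ⟨m, hm, hconst m hm, hP⟩
    have hall : ∀ N k, ∃ n ≥ N, c n = (cyclicSucc ι)^[k] (c N) := by
      intro N k
      induction k with
      | zero => exact ⟨N, le_rfl, rfl⟩
      | succ k ih =>
        obtain ⟨n, hn, hc⟩ := ih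
        obtain ⟨m, hm, hcm, hP⟩ := hrel n
        refine ⟨m + 1, by omega, ?_⟩
        rw [hmove m (by rwa [hcm]), hcm, hc, Function.iterate_succ_apply']
    rw [frequently_atTop]
    intro N
    obtain ⟨k, hk⟩ := exists_iterate_cyclicSucc (c N) i₀
    obtain ⟨n, hn, hc⟩ := hall N k
    obtain ⟨m, hm, hcm, hP⟩ := hrel n
    rw [hc, hk] at hcm hP
    exact ⟨m, by omega, hcm, hP⟩

theorem mem_language_iInter (i₀ : ι) (A : ι → DBA α) [∀ i, Finite (A i).Q] (w : ℕ → α) :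
    w ∈ (iInter i₀ A).language ↔ ∀ i, w ∈ (A i).language := by
  have hfin : Finite (iInter i₀ A).Q := inferInstanceAs (Finite ((∀ i, (A i).Q) × ι))
  have hrw : ∀ n, (iInter i₀ A).run w n ∈ (iInter i₀ A).acc ↔
      ((iInter i₀ A).run w n).2 = i₀ ∧ (A i₀).run w n ∈ (A i₀).acc := fun n => by
    rw [← iInter_run_fst i₀ A w n]
    rfl
  simp only [language, Set.mem_ofPred_eq, buchiAccepting_iff_frequently, hrw]
  exact frequently_counter_iff i₀ (fun i n => (A i).run w n ∈ (A i).acc) _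
    (fun n h => by rw [iInter_run_snd_succ, if_pos h])
    (fun n h => by rw [iInter_run_snd_succ, if_neg h])

/-! ### The languages of the component automata -/

variable {Ap : Type u}

theorem nuAut_run (θ : LTL Ap) (w : ℕ → Set Ap) (n : ℕ) :
    ((nuAut (PropClass.mk θ)).run w n).1 = PropClass.mk (θ.afRun w n) := by
  induction n with
  | zero => rfl
  | succ n ih =>
    change PropClass.af ((nuAut (PropClass.mk θ)).run w n).1 (w n) = _
    rw [ih]; rfl

theorem mem_language_nuAut {θ : LTL Ap} (hθ : ∀ χ ∈ θ.sf, ¬ χ.IsMu)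
    [Finite (PropClass.mk θ).reach] (w : ℕ → Set Ap) :
    w ∈ (nuAut (PropClass.mk θ)).language ↔ θ.Sat w := by
  have : Finite (nuAut (PropClass.mk θ)).Q := ‹_›
  have hrw : ∀ n, (nuAut (PropClass.mk θ)).run w n ∈ (nuAut (PropClass.mk θ)).acc ↔
      PropClass.mk (θ.afRun w n) ≠ PropClass.mk LTL.ff := fun n => by
    rw [← nuAut_run]; rfl
  simp only [language, Set.mem_ofPred_eq, buchiAccepting_iff_frequently, hrw,
    LTL.sat_iff_forall_ne_ff hθ]
  refine ⟨fun h n hn => ?_, fun h => (Eventually.of_forall h).frequently⟩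
  obtain ⟨m, hm, hne⟩ := frequently_atTop.1 h n
  exact hne ((LTL.mk_eq_ff_iff _).2
    (LTL.not_propEval_afRun_mono hm ((LTL.mk_eq_ff_iff _).1 hn)))

/-- If the automaton is in its initial state at position `k`, then from there on it is always in
the state that `F ψ` reaches from the last restart, at some position `s ≥ k`. -/
theorem gfAut_run_of_init (ψ : LTL Ap) (w : ℕ → Set Ap) {k n : ℕ}
    (hk : ((gfAut ψ).run w k).1 = PropClass.mk (LTL.F ψ)) (hn : k ≤ n) :
    ∃ s t, k ≤ s ∧ s + t = n ∧
      ((gfAut ψ).run w n).1 = PropClass.mk ((LTL.F ψ).afRun (wordSuffix w s) t) := by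
  induction n, hn using Nat.le_induction with
  | base => exact ⟨k, 0, le_rfl, rfl, hk⟩
  | succ n hn ih =>
    obtain ⟨s, t, hs, rfl, h⟩ := ih
    by_cases htt : ((gfAut ψ).run w (s + t)).1 = PropClass.mk LTL.tt
    · exact ⟨s + t + 1, 0, by omega, rfl, congrArg Subtype.val (if_pos htt)⟩
    · refine ⟨s, t + 1, hs, rfl, (congrArg Subtype.val (if_neg htt)).trans ?_⟩
      change PropClass.af ((gfAut ψ).run w (s + t)).1 (w (s + t)) = _
      rw [h]; rfl

theorem mem_language_gfAut {ψ : LTL Ap} (hψ : ∀ χ ∈ ψ.sf, ¬ χ.IsNu)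
    [Finite (PropClass.mk (LTL.F ψ)).reach] (w : ℕ → Set Ap) :
    w ∈ (gfAut ψ).language ↔ (LTL.G (LTL.F ψ)).Sat w := by
  have : Finite (gfAut ψ).Q := ‹_›
  have hF : ∀ χ ∈ (LTL.F ψ).sf, ¬ χ.IsNu := by
    simpa [LTL.sf, LTL.IsNu] using hψ
  have hrw : ∀ n, (gfAut ψ).run w n ∈ (gfAut ψ).acc ↔
      ((gfAut ψ).run w n).1 = PropClass.mk LTL.tt := fun n => Iff.rfl
  simp only [language, Set.mem_ofPred_eq, buchiAccepting_iff_frequently, hrw]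
  constructor
  · intro h k
    obtain ⟨n, hn, htt⟩ := frequently_atTop.1 h k
    obtain ⟨m, hm, htt'⟩ := frequently_atTop.1 h (n + 1)
    obtain ⟨s, t, hs, rfl, hst⟩ := gfAut_run_of_init ψ w
      (show ((gfAut ψ).run w (n + 1)).1 = _ from congrArg Subtype.val (if_pos htt)) hm
    have hsat : (LTL.F ψ).Sat (wordSuffix w s) :=
      (LTL.sat_afRun _ _ t).1 ((LTL.sat_congr (hst.symm.trans htt') _).2 trivial)
    refine LTL.Sat.F_of_wordSuffix (k := s - k) ?_
    rwa [wordSuffix_wordSuffix, Nat.add_sub_cancel' (by omega)]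
  · intro h
    rw [frequently_atTop]
    intro N
    by_contra! hc
    -- without further restarts after `N` the state follows `F ψ` from the last restart
    obtain ⟨s, t, -, rfl, hst⟩ := gfAut_run_of_init ψ w (k := 0) rfl (Nat.zero_le N)
    have hrun : ∀ j, ((gfAut ψ).run w (s + t + j)).1 =
        PropClass.mk ((LTL.F ψ).afRun (wordSuffix w s) (t + j)) := by
      intro j
      induction j with
      | zero => exact hst
      | succ j ih =>
        refine (congrArg Subtype.val (if_neg (hc (s + t + j) (by omega)))).trans ?_
        change PropClass.af ((gfAut ψ).run w (s + t + j)).1 (w (s + t + j)) = _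
        rw [ih, add_assoc]; rfl
    obtain ⟨m, hm⟩ := LTL.validated_of_sat hF (h s)
    refine hc (s + t + m) (by omega) ((hrun m).trans ((LTL.mk_eq_tt_iff _).2 ?_))
    exact LTL.propEval_afRun_mono (Nat.le_add_left m t) hm

end DBA

namespace LTL

variable {Ap : Type u}

/-! ### Counting classes of formulas -/

/-- `φ` is a positive Boolean combination of formulas in `V`. -/
def IsCombination (V : Finset (LTL Ap)) : LTL Ap → Prop
  | tt => True
  | ff => True
  | conj φ ψ => φ.IsCombination V ∧ ψ.IsCombination V
  | disj φ ψ => φ.IsCombination V ∧ ψ.IsCombination V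
  | φ => φ ∈ V

theorem isCombination_of_sf_subset {V : Finset (LTL Ap)} {φ : LTL Ap} (h : φ.sf ⊆ V) :
    φ.IsCombination V := by
  induction φ with
  | tt | ff => trivial
  | conj φ ψ h₁ h₂ | disj φ ψ h₁ h₂ =>
    simp only [sf, Finset.insert_subset_iff, Finset.union_subset_iff] at h
    exact ⟨h₁ h.2.1, h₂ h.2.2⟩
  | _ => exact h (self_mem_sf _)

theorem isCombination_af_of_sf_subset {V : Finset (LTL Ap)} {φ : LTL Ap} (h : φ.sf ⊆ V)
    (ν : Set Ap) : (φ.af ν).IsCombination V := by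
  have hself := h (self_mem_sf _)
  induction φ with
  | tt | ff => trivial
  | pos a | neg a => simp only [af]; split_ifs <;> trivial
  | X φ _ =>
    simp only [sf, Finset.insert_subset_iff] at h
    exact isCombination_of_sf_subset h.2
  | F φ ih | G φ ih =>
    simp only [sf, Finset.insert_subset_iff] at h
    exact ⟨ih h.2 (h.2 (self_mem_sf _)), hself⟩
  | conj φ ψ h₁ h₂ | disj φ ψ h₁ h₂ =>
    simp only [sf, Finset.insert_subset_iff, Finset.union_subset_iff] at h
    exact ⟨h₁ h.2.1 (h.2.1 (self_mem_sf _)), h₂ h.2.2 (h.2.2 (self_mem_sf _))⟩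
  | U φ ψ h₁ h₂ | W φ ψ h₁ h₂ | M φ ψ h₁ h₂ | R φ ψ h₁ h₂ =>
    simp only [sf, Finset.insert_subset_iff, Finset.union_subset_iff] at h
    exact ⟨h₂ h.2.2 (h.2.2 (self_mem_sf _)), h₁ h.2.1 (h.2.1 (self_mem_sf _)), hself⟩

/-- If `V` is closed under subformulas, then combinations of `V` are closed under `af`. -/
theorem IsCombination.af {V : Finset (LTL Ap)} (hV : ∀ χ ∈ V, χ.sf ⊆ V) {φ : LTL Ap}
    (h : φ.IsCombination V) (ν : Set Ap) : (φ.af ν).IsCombination V := by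
  induction φ with
  | tt | ff => trivial
  | conj φ ψ h₁ h₂ | disj φ ψ h₁ h₂ => exact ⟨h₁ h.1, h₂ h.2⟩
  | _ => exact isCombination_af_of_sf_subset (hV _ h) ν

theorem propEval_congr {V : Finset (LTL Ap)} {φ : LTL Ap} (h : φ.IsCombination V)
    {I J : LTL Ap → Prop} (hIJ : ∀ χ ∈ V, I χ ↔ J χ) : φ.propEval I ↔ φ.propEval J := by
  induction φ with
  | tt | ff => rfl
  | conj φ ψ h₁ h₂ => exact and_congr (h₁ h.1) (h₂ h.2)
  | disj φ ψ h₁ h₂ => exact or_congr (h₁ h.1) (h₂ h.2)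
  | _ => exact hIJ _ h

/-- The set of models of a class of formulas over the variables in `V`. -/
def models (V : Finset (LTL Ap)) (c : PropClass Ap) : Set (Set V) :=
  {A | Quotient.lift (fun φ : LTL Ap => φ.propEval fun χ => ∃ h : χ ∈ V, (⟨χ, h⟩ : V) ∈ A)
    (fun _ _ h => propext ((h : PropEquiv _ _) _)) c}

theorem injOn_models (V : Finset (LTL Ap)) :
    Set.InjOn (models V) {c | ∃ φ : LTL Ap, φ.IsCombination V ∧ c = PropClass.mk φ} := by
  rintro _ ⟨φ, hφ, rfl⟩ _ ⟨ψ, hψ, rfl⟩ h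
  refine Quotient.sound fun I => ?_
  have hI : ∀ χ ∈ V, I χ ↔ ∃ h : χ ∈ V, (⟨χ, h⟩ : V) ∈ {χ : V | I χ} := fun χ hχ =>
    ⟨fun h => ⟨hχ, h⟩, fun ⟨_, h⟩ => h⟩
  rw [propEval_congr hφ hI, propEval_congr hψ hI]
  exact iff_of_eq (congrArg (fun S : Set (Set V) => {χ : V | I χ} ∈ S) h)

theorem card_reach_le {V : Finset (LTL Ap)} (hV : ∀ χ ∈ V, χ.sf ⊆ V) {φ : LTL Ap}
    (h : φ.IsCombination V) : Finite (PropClass.mk φ).reach ∧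
      Nat.card (PropClass.mk φ).reach ≤ 2 ^ 2 ^ V.card := by
  have hsub : (PropClass.mk φ).reach ⊆
      {c | ∃ φ : LTL Ap, φ.IsCombination V ∧ c = PropClass.mk φ} := by
    intro c hc
    obtain ⟨u, rfl⟩ := (mem_Reach φ c).1 hc
    refine ⟨_, ?_, rfl⟩
    clear hc
    induction u generalizing φ with
    | nil => exact h
    | cons ν u ih => exact ih (h.af hV ν)
  have hinj : Function.Injective fun c : (PropClass.mk φ).reach => models V c.1 :=
    fun c d hcd => Subtype.ext (injOn_models V (hsub c.2) (hsub d.2) hcd)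
  refine ⟨Finite.of_injective _ hinj, (Nat.card_le_card_of_injective _ hinj).trans_eq ?_⟩
  classical
  simp [Nat.card_eq_fintype_card, Fintype.card_set]

theorem card_sf_le (φ : LTL Ap) : φ.sf.card ≤ φ.length := by
  classical
  induction φ with
  | tt | ff | pos | neg => simp [sf, length]
  | X φ ih | F φ ih | G φ ih =>
    simp only [sf, length]
    exact (Finset.card_insert_le _ _).trans (by omega)
  | conj φ ψ h₁ h₂ | disj φ ψ h₁ h₂ | U φ ψ h₁ h₂ | W φ ψ h₁ h₂ | M φ ψ h₁ h₂ | R φ ψ h₁ h₂ =>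
    simp only [sf, length]
    have h := Finset.card_union_le φ.sf ψ.sf
    refine le_trans (Finset.card_insert_le _ _) ?_
    omega

theorem length_pos (φ : LTL Ap) : 1 ≤ φ.length := by
  cases φ <;> simp [length]

theorem card_Reach_le (φ : LTL Ap) : Finite φ.Reach ∧ Nat.card φ.Reach ≤ 2 ^ 2 ^ φ.length := by
  obtain ⟨h₁, h₂⟩ := card_reach_le (V := φ.sf) (fun χ => sf_subset)
    (isCombination_of_sf_subset subset_rfl)
  refine ⟨h₁, h₂.trans ?_⟩
  gcongr
  exacts [one_le_two, one_le_two, card_sf_le φ]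

open Classical in
theorem sf_evalNu_subset (S : Finset (LTL Ap)) (φ : LTL Ap) :
    (φ.evalNu S).sf ⊆ φ.sf.image (evalNu S) := by
  induction φ with
  | tt | ff | pos | neg => simp [evalNu, sf]
  | X φ ih | G φ ih =>
    simp only [evalNu, sf, Finset.image_insert]
    exact Finset.insert_subset_insert _ ih
  | F φ ih =>
    simp only [evalNu, sf, Finset.image_insert]
    split_ifs <;> simp [sf]
  | conj φ ψ h₁ h₂ | disj φ ψ h₁ h₂ | W φ ψ h₁ h₂ | R φ ψ h₁ h₂ =>
    simp only [evalNu, sf, Finset.image_insert, Finset.image_union]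
    exact Finset.insert_subset_insert _ (Finset.union_subset_union h₁ h₂)
  | U φ ψ h₁ h₂ | M φ ψ h₁ h₂ =>
    simp only [evalNu, sf, Finset.image_insert, Finset.image_union]
    split_ifs
    · exact Finset.insert_subset_insert _ (Finset.union_subset_union h₁ h₂)
    · simp [sf]

open Classical in
theorem sf_evalMu_subset (S : Finset (LTL Ap)) (φ : LTL Ap) :
    (φ.evalMu S).sf ⊆ φ.sf.image (evalMu S) := by
  induction φ with
  | tt | ff | pos | neg => simp [evalMu, sf]
  | X φ ih | F φ ih =>
    simp only [evalMu, sf, Finset.image_insert]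
    exact Finset.insert_subset_insert _ ih
  | G φ ih =>
    simp only [evalMu, sf, Finset.image_insert]
    split_ifs <;> simp [sf]
  | conj φ ψ h₁ h₂ | disj φ ψ h₁ h₂ | U φ ψ h₁ h₂ | M φ ψ h₁ h₂ =>
    simp only [evalMu, sf, Finset.image_insert, Finset.image_union]
    exact Finset.insert_subset_insert _ (Finset.union_subset_union h₁ h₂)
  | W φ ψ h₁ h₂ | R φ ψ h₁ h₂ =>
    simp only [evalMu, sf, Finset.image_insert, Finset.image_union]
    split_ifs
    · simp [sf]
    · exact Finset.insert_subset_insert _ (Finset.union_subset_union h₁ h₂)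

open Classical in
theorem IsCombination.evalNu {φ ψ : LTL Ap} (h : ψ.IsCombination φ.sf) (S : Finset (LTL Ap)) :
    (ψ.evalNu S).IsCombination (φ.sf.image (evalNu S)) := by
  induction ψ with
  | tt | ff => trivial
  | conj φ ψ h₁ h₂ | disj φ ψ h₁ h₂ => exact ⟨h₁ h.1, h₂ h.2⟩
  | _ =>
    exact isCombination_of_sf_subset
      ((sf_evalNu_subset S _).trans (Finset.image_subset_image (sf_subset h)))

theorem isCombination_of_mk_mem_Reach {φ : LTL Ap} {c : PropClass Ap} (hc : c ∈ φ.Reach) :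
    ∃ ψ : LTL Ap, ψ.IsCombination φ.sf ∧ c = PropClass.mk ψ := by
  obtain ⟨u, rfl⟩ := (mem_Reach φ c).1 hc
  refine ⟨_, ?_, rfl⟩
  have key : ∀ (u : List (Set Ap)) (ψ : LTL Ap), ψ.IsCombination φ.sf →
      (ψ.afWord u).IsCombination φ.sf := by
    intro u
    induction u with
    | nil => exact fun ψ h => h
    | cons ν u ih => exact fun ψ h => ih _ (h.af (fun χ => sf_subset) ν)
  exact key u φ (isCombination_of_sf_subset subset_rfl)

theorem card_reach_evalNu_le {φ : LTL Ap} {c : PropClass Ap} (hc : c ∈ φ.Reach)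
    (S : Finset (LTL Ap)) : Finite (c.evalNu S).reach ∧
      Nat.card (c.evalNu S).reach ≤ 2 ^ 2 ^ φ.length := by
  classical
  obtain ⟨ψ, hψ, rfl⟩ := isCombination_of_mk_mem_Reach hc
  obtain ⟨h₁, h₂⟩ := card_reach_le (V := φ.sf.image (evalNu S)) (fun χ hχ => by
    obtain ⟨ξ, hξ, rfl⟩ := Finset.mem_image.1 hχ
    exact (sf_evalNu_subset S _).trans (Finset.image_subset_image (sf_subset hξ))) (hψ.evalNu S)
  refine ⟨h₁, h₂.trans ?_⟩
  gcongr
  exacts [one_le_two, one_le_two, Finset.card_image_le.trans (card_sf_le φ)]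

theorem card_reach_G_evalNu_le (S : Finset (LTL Ap)) (χ : LTL Ap) :
    Finite (PropClass.mk (G (χ.evalNu S))).reach ∧
      Nat.card (PropClass.mk (G (χ.evalNu S))).reach ≤ 2 ^ 2 ^ (χ.sf.card + 1) := by
  classical
  obtain ⟨h₁, h₂⟩ := card_reach_le (V := (G (χ.evalNu S)).sf) (fun _ => sf_subset)
    (isCombination_of_sf_subset subset_rfl)
  refine ⟨h₁, h₂.trans ?_⟩
  gcongr
  exacts [one_le_two, one_le_two, (Finset.card_insert_le _ _).trans
    (Nat.succ_le_succ ((Finset.card_le_card (sf_evalNu_subset S χ)).trans Finset.card_image_le))]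

theorem card_reach_F_evalMu_le (S : Finset (LTL Ap)) (χ : LTL Ap) :
    Finite (PropClass.mk (F (χ.evalMu S))).reach ∧
      Nat.card (PropClass.mk (F (χ.evalMu S))).reach ≤ 2 ^ 2 ^ (χ.sf.card + 1) := by
  classical
  obtain ⟨h₁, h₂⟩ := card_reach_le (V := (F (χ.evalMu S)).sf) (fun _ => sf_subset)
    (isCombination_of_sf_subset subset_rfl)
  refine ⟨h₁, h₂.trans ?_⟩
  gcongr
  exacts [one_le_two, one_le_two, (Finset.card_insert_le _ _).trans
    (Nat.succ_le_succ ((Finset.card_le_card (sf_evalMu_subset S χ)).trans Finset.card_image_le))]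

end LTL

/-! ### The automata for a guess of advice -/

theorem two_mul_add_one_le_two_pow (n : ℕ) (hn : 1 ≤ n) : 2 * n + 1 ≤ 2 ^ (2 * n) := by
  induction n, hn using Nat.le_induction with
  | base => norm_num
  | succ n _ ih =>
    rw [show 2 * (n + 1) = 2 * n + 2 by ring, pow_add]
    omega

namespace DBA

variable {Ap : Type u}

/-- The index type of the product that makes up `DBA.D`. -/
abbrev DIndex (X Y : Finset (LTL Ap)) : Type u := Option ({χ // χ ∈ X} ⊕ {χ // χ ∈ Y})

/-- The factors of the product that makes up `DBA.D`. -/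
noncomputable def factor (c : PropClass Ap) (X Y : Finset (LTL Ap)) :
    DIndex X Y → DBA (Set Ap)
  | none => nuAut (c.evalNu X)
  | some (Sum.inl χ) => gfAut (χ.1.evalMu Y)
  | some (Sum.inr χ) => nuAut (PropClass.mk (LTL.G (χ.1.evalNu X)))

theorem D_eq_iInter (c : PropClass Ap) (X Y : Finset (LTL Ap)) :
    D c X Y = iInter none (factor c X Y) := by
  unfold D
  congr 1

theorem card_factor_le {φ : LTL Ap} {c : PropClass Ap} (hc : c ∈ φ.Reach)
    {X Y : Finset (LTL Ap)} (hX : X ⊆ φ.muSub) (hY : Y ⊆ φ.nuSub) (i : DIndex X Y) :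
    Finite (factor c X Y i).Q ∧ Nat.card (factor c X Y i).Q ≤ 2 ^ 2 ^ (φ.length + 1) := by
  have hlen : ∀ χ ∈ φ.sf, χ.sf.card + 1 ≤ φ.length + 1 := fun χ hχ =>
    Nat.succ_le_succ ((Finset.card_le_card (LTL.sf_subset hχ)).trans (LTL.card_sf_le φ))
  have hpow : ∀ {k l : ℕ}, k ≤ l → 2 ^ 2 ^ k ≤ 2 ^ 2 ^ l := fun h =>
    Nat.pow_le_pow_right two_pos (Nat.pow_le_pow_right two_pos h)
  rcases i with _ | χ | χ
  · exact (LTL.card_reach_evalNu_le hc X).imp_right fun h => h.trans (hpow (Nat.le_succ _))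
  · exact (LTL.card_reach_F_evalMu_le Y χ.1).imp_right fun h =>
      h.trans (hpow (hlen _ (LTL.muSub_subset_sf φ (hX χ.2))))
  · exact (LTL.card_reach_G_evalNu_le X χ.1).imp_right fun h =>
      h.trans (hpow (hlen _ (LTL.nuSub_subset_sf φ (hY χ.2))))

theorem card_D_le {φ : LTL Ap} {c : PropClass Ap} (hc : c ∈ φ.Reach)
    {X Y : Finset (LTL Ap)} (hX : X ⊆ φ.muSub) (hY : Y ⊆ φ.nuSub) :
    Finite (D c X Y).Q ∧ Nat.card (D c X Y).Q ≤ 2 ^ 2 ^ (5 * φ.length) := by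
  have hfin : ∀ i, Finite (factor c X Y i).Q := fun i => (card_factor_le hc hX hY i).1
  rw [D_eq_iInter]
  refine ⟨inferInstanceAs (Finite ((∀ i, (factor c X Y i).Q) × DIndex X Y)), ?_⟩
  change Nat.card ((∀ i, (factor c X Y i).Q) × DIndex X Y) ≤ _
  set n := φ.length with hn
  have hn1 : 1 ≤ n := LTL.length_pos φ
  have hcard : Fintype.card (DIndex X Y) ≤ 2 * n + 1 := by
    have h₁ : X.card ≤ n := (Finset.card_le_card
      (hX.trans (LTL.muSub_subset_sf φ))).trans (LTL.card_sf_le φ)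
    have h₂ : Y.card ≤ n := (Finset.card_le_card
      (hY.trans (LTL.nuSub_subset_sf φ))).trans (LTL.card_sf_le φ)
    simp only [Fintype.card_option, Fintype.card_sum, Fintype.card_coe]
    omega
  have h2n := two_mul_add_one_le_two_pow n hn1
  rw [Nat.card_prod, Nat.card_pi, Nat.card_eq_fintype_card (α := DIndex X Y)]
  calc (∏ i, Nat.card (factor c X Y i).Q) * Fintype.card (DIndex X Y)
      ≤ (∏ _i : DIndex X Y, 2 ^ 2 ^ (n + 1)) * (2 * n + 1) :=
        Nat.mul_le_mul (Finset.prod_le_prod' fun i _ => (card_factor_le hc hX hY i).2) hcard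
    _ ≤ (2 ^ 2 ^ (n + 1)) ^ (2 * n + 1) * 2 ^ (2 * n + 1) := by
        rw [Finset.prod_const, Finset.card_univ]
        exact Nat.mul_le_mul (Nat.pow_le_pow_right (by positivity) hcard)
          Nat.lt_two_pow_self.le
    _ = 2 ^ ((2 ^ (n + 1) + 1) * (2 * n + 1)) := by
        rw [← pow_mul, ← pow_add]; ring_nf
    _ ≤ 2 ^ 2 ^ (5 * n) := by
        refine Nat.pow_le_pow_right two_pos ?_
        calc (2 ^ (n + 1) + 1) * (2 * n + 1) ≤ 2 ^ (n + 2) * 2 ^ (2 * n) := by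
              refine Nat.mul_le_mul ?_ h2n
              have := Nat.one_le_two_pow (n := n + 1)
              rw [pow_succ 2 (n + 1)]
              omega
          _ = 2 ^ (n + 2 + 2 * n) := (pow_add _ _ _).symm
          _ ≤ 2 ^ (5 * n) := Nat.pow_le_pow_right two_pos (by omega)

theorem mem_language_D {φ ψ : LTL Ap} (hψ : PropClass.mk ψ ∈ φ.Reach)
    {X Y : Finset (LTL Ap)} (hX : X ⊆ φ.muSub) (hY : Y ⊆ φ.nuSub) (w : ℕ → Set Ap) :
    w ∈ (D (PropClass.mk ψ) X Y).language ↔ (ψ.evalNu X).Sat w ∧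
      (∀ χ ∈ X, (LTL.G (LTL.F (χ.evalMu Y))).Sat w) ∧
      (∀ χ ∈ Y, (LTL.G (χ.evalNu X)).Sat w) := by
  have hfin : ∀ i, Finite (factor (PropClass.mk ψ) X Y i).Q := fun i =>
    (card_factor_le hψ hX hY i).1
  rw [D_eq_iInter, mem_language_iInter, Option.forall, Sum.forall, Subtype.forall,
    Subtype.forall]
  refine and_congr ?_ (and_congr (forall₂_congr fun χ hχ => ?_) (forall₂_congr fun χ hχ => ?_))
  · have : Finite (PropClass.mk (ψ.evalNu X)).reach := hfin none
    exact mem_language_nuAut (LTL.not_isMu_of_mem_sf_evalNu X ψ) w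
  · have : Finite (PropClass.mk (LTL.F (χ.evalMu Y))).reach := hfin (some (Sum.inl ⟨χ, hχ⟩))
    exact mem_language_gfAut (LTL.not_isNu_of_mem_sf_evalMu Y χ) w
  · have : Finite (PropClass.mk (LTL.G (χ.evalNu X))).reach := hfin (some (Sum.inr ⟨χ, hχ⟩))
    have hG : ∀ ξ ∈ (LTL.G (χ.evalNu X)).sf, ¬ ξ.IsMu :=
      LTL.not_isMu_of_mem_sf_evalNu X (LTL.G χ)
    exact mem_language_nuAut hG w

end DBA

/-! ### Runs of the limit-deterministic automaton -/

/-- Büchi acceptance depends only on a tail of the sequence, here embedded by `f` into a larger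
state space. -/
theorem buchiAccepting_iff_of_tail {Q Q' : Type u} {S : Set Q} {T : Set Q'} {r : ℕ → Q}
    {ρ : ℕ → Q'} {f : Q' → Q} (hf : Function.Injective f) (hST : ∀ q, f q ∈ S ↔ q ∈ T)
    {a b : ℕ} (h : ∀ k ≥ b, r (a + k) = f (ρ k)) :
    BuchiAccepting S r ↔ BuchiAccepting T ρ := by
  constructor
  · rintro ⟨q, hq, hr⟩
    rw [frequently_atTop] at hr
    have key : ∀ N, ∃ k ≥ N, q = f (ρ k) := fun N => by
      obtain ⟨n, hn, hrn⟩ := hr (a + b + N)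
      refine ⟨n - a, by omega, ?_⟩
      rw [← h _ (by omega), Nat.add_sub_cancel' (by omega), hrn]
    obtain ⟨k₀, -, hk₀⟩ := key 0
    refine ⟨ρ k₀, (hST _).1 (hk₀ ▸ hq), frequently_atTop.2 fun N => ?_⟩
    obtain ⟨k, hk, hqk⟩ := key N
    exact ⟨k, hk, hf (hqk.symm.trans hk₀)⟩
  · rintro ⟨q, hq, hr⟩
    refine ⟨f q, (hST q).2 hq, frequently_atTop.2 fun N => ?_⟩
    obtain ⟨k, hk, hqk⟩ := frequently_atTop.1 hr (b + N)
    exact ⟨a + k, by omega, by rw [h k (by omega), hqk]⟩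

namespace LTL

variable {Ap : Type u}

/-- The state `[af(φ, u)]_P` that the initial component reaches on the prefix `u` of length `n`
of `w`. -/
noncomputable def reachState (φ : LTL Ap) (w : ℕ → Set Ap) (n : ℕ) : φ.Reach :=
  ⟨PropClass.mk (φ.afRun w n), by
    induction n with
    | zero => exact PropClass.self_mem_reach _
    | succ n ih => exact PropClass.af_mem_reach ih (w n)⟩

/-- The triple for a jump with advice `X` and `Y` after `n` letters of `w`. -/
noncomputable def jumpIndex (φ : LTL Ap) (w : ℕ → Set Ap) (n : ℕ)
    (X : {X : Finset (LTL Ap) // X ⊆ φ.muSub}) (Y : {Y : Finset (LTL Ap) // Y ⊆ φ.nuSub}) :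
    φ.JumpIndex := (φ.reachState w n, X, Y)

/-- A state of the initial component, as a state of the whole automaton. -/
def inInitial (φ : LTL Ap) (c : φ.Reach) : φ.ldba.Q := Sum.inl c

/-- A state of a DBA of the accepting component, as a state of the whole automaton. -/
def inAccepting (φ : LTL Ap) (i : φ.JumpIndex) (q : (φ.jumpDBA i).Q) : φ.ldba.Q := Sum.inr ⟨i, q⟩

theorem inAccepting_injective (φ : LTL Ap) (i : φ.JumpIndex) :
    Function.Injective (φ.inAccepting i) := fun _ _ h =>
  eq_of_heq (Sigma.mk.inj (Sum.inr.inj h)).2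

theorem inAccepting_mem_acc (φ : LTL Ap) (i : φ.JumpIndex) (q : (φ.jumpDBA i).Q) :
    φ.inAccepting i q ∈ φ.ldba.acc ↔ q ∈ (φ.jumpDBA i).acc := by
  constructor
  · rintro ⟨s, hs, h⟩
    obtain rfl : (⟨i, q⟩ : Σ i : φ.JumpIndex, (φ.jumpDBA i).Q) = s := Sum.inr.inj hs
    exact h
  · exact fun h => ⟨⟨i, q⟩, rfl, h⟩

theorem cases_state (φ : LTL Ap) (q : φ.ldba.Q) :
    (∃ c, q = φ.inInitial c) ∨ ∃ i s, q = φ.inAccepting i s := by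
  rcases q with c | ⟨i, s⟩
  · exact Or.inl ⟨c, rfl⟩
  · exact Or.inr ⟨i, s, rfl⟩

theorem inInitial_ne_inAccepting (φ : LTL Ap) (c : φ.Reach) (i : φ.JumpIndex)
    (s : (φ.jumpDBA i).Q) : φ.inInitial c ≠ φ.inAccepting i s := Sum.inl_ne_inr

theorem ldba_Δ_reachState (φ : LTL Ap) (w : ℕ → Set Ap) (n : ℕ) :
    φ.ldba.Δ (φ.inInitial (φ.reachState w n)) (w n) =
      {φ.inInitial (φ.reachState w (n + 1))} := rfl

theorem ldba_Δ_inAccepting (φ : LTL Ap) (i : φ.JumpIndex) (s : (φ.jumpDBA i).Q) (ν : Set Ap) :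
    φ.ldba.Δ (φ.inAccepting i s) ν = {φ.inAccepting i ((φ.jumpDBA i).step s ν)} := rfl

theorem ldba_eps_inAccepting (φ : LTL Ap) (i : φ.JumpIndex) (s : (φ.jumpDBA i).Q) :
    φ.ldba.eps (φ.inAccepting i s) = ∅ := rfl

theorem mem_ldba_eps_reachState (φ : LTL Ap) (w : ℕ → Set Ap) (n : ℕ) (q : φ.ldba.Q) :
    q ∈ φ.ldba.eps (φ.inInitial (φ.reachState w n)) ↔
      ∃ X Y, q = φ.inAccepting (φ.jumpIndex w n X Y) (φ.jumpDBA (φ.jumpIndex w n X Y)).init :=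
  Iff.rfl

/-- A sequence of states with an accepting state starts in the initial component and, at some
step, leaves it for the accepting component. -/
theorem exists_first_inAccepting {φ : LTL Ap} {r : ℕ → φ.ldba.Q}
    (h0 : r 0 ∈ φ.ldba.init) (hacc : BuchiAccepting φ.ldba.acc r) :
    ∃ n, (∀ m ≤ n, ∃ c, r m = φ.inInitial c) ∧ ∃ i s, r (n + 1) = φ.inAccepting i s := by
  classical
  have hex : ∃ n, ∃ i s, r n = φ.inAccepting i s := by
    obtain ⟨q, ⟨⟨i, s⟩, rfl, -⟩, hf⟩ := hacc
    obtain ⟨n, hn⟩ := hf.exists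
    exact ⟨n, i, s, hn⟩
  obtain ⟨n, hn⟩ : ∃ n, Nat.find hex = n + 1 := by
    refine Nat.exists_eq_succ_of_ne_zero fun h => ?_
    obtain ⟨i, s, his⟩ := Nat.find_spec hex
    rw [h] at his
    exact φ.inInitial_ne_inAccepting _ _ _ (Eq.trans (Eq.symm h0) his)
  refine ⟨n, fun m hm => ?_, hn ▸ Nat.find_spec hex⟩
  exact (φ.cases_state (r m)).resolve_right (Nat.find_min hex (by omega))

/-- An accepting run follows `af` in the initial component for some `n` letters, jumps, and
then is the run of one of the DBAs on the rest of the word. -/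
theorem exists_jump_of_isAcceptingRun {φ : LTL Ap} {w : ℕ → Set Ap} {r : ℕ → φ.ldba.Q}
    {p : ℕ → ℕ} (h : φ.ldba.IsAcceptingRun w r p) :
    ∃ n, (∀ m ≤ n, p m = m ∧ r m = φ.inInitial (φ.reachState w m)) ∧
      ∃ X Y, ∀ k, p (n + 1 + k) = n + k ∧
        r (n + 1 + k) = φ.inAccepting (φ.jumpIndex w n X Y)
          ((φ.jumpDBA (φ.jumpIndex w n X Y)).run (wordSuffix w n) k) := by
  obtain ⟨hrun, hacc⟩ := h
  obtain ⟨n, hinit, i, s, hs⟩ := exists_first_inAccepting hrun.start hacc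
  have hbefore : ∀ m ≤ n, p m = m ∧ r m = φ.inInitial (φ.reachState w m) := by
    intro m
    induction m with
    | zero => exact fun _ => ⟨hrun.pos_zero, hrun.start⟩
    | succ m ih =>
      intro hm
      obtain ⟨hp, hr⟩ := ih (by omega)
      rcases hrun.step m with ⟨hp', hr'⟩ | ⟨-, hr'⟩
      · rw [hp, hr, ldba_Δ_reachState] at hr'
        exact ⟨by omega, hr'⟩
      · rw [hr, mem_ldba_eps_reachState] at hr'
        obtain ⟨X, Y, hXY⟩ := hr'
        obtain ⟨c, hc⟩ := hinit (m + 1) hm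
        exact (φ.inInitial_ne_inAccepting _ _ _ (hc.symm.trans hXY)).elim
  refine ⟨n, hbefore, ?_⟩
  obtain ⟨hpn, hrn⟩ := hbefore n le_rfl
  obtain ⟨hpn', X, Y, hXY⟩ : p (n + 1) = n ∧ ∃ X Y, r (n + 1) =
      φ.inAccepting (φ.jumpIndex w n X Y) (φ.jumpDBA (φ.jumpIndex w n X Y)).init := by
    rcases hrun.step n with ⟨-, hr'⟩ | ⟨hp', hr'⟩
    · rw [hpn, hrn, ldba_Δ_reachState] at hr'
      exact (φ.inInitial_ne_inAccepting _ _ _ (Eq.trans (Eq.symm hr') hs)).elim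
    · rw [hrn, mem_ldba_eps_reachState] at hr'
      exact ⟨hp'.trans hpn, hr'⟩
  refine ⟨X, Y, fun k => ?_⟩
  induction k with
  | zero => exact ⟨hpn', hXY⟩
  | succ k ih =>
    obtain ⟨hp, hr⟩ := ih
    rcases hrun.step (n + 1 + k) with ⟨hp', hr'⟩ | ⟨-, hr'⟩
    · rw [hp, hr, ldba_Δ_inAccepting] at hr'
      exact ⟨by rw [← add_assoc, hp', hp, add_assoc], hr'⟩
    · rw [hr, ldba_eps_inAccepting] at hr'
      exact hr'.elim

theorem toNBA_Δ_inAccepting (φ : LTL Ap) (i : φ.JumpIndex) (s : (φ.jumpDBA i).Q) (ν : Set Ap) :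
    φ.ldba.toNBA.Δ (φ.inAccepting i s) ν = {φ.inAccepting i ((φ.jumpDBA i).step s ν)} := by
  ext q
  constructor
  · rintro ⟨q', hq', hq⟩
    rcases Relation.ReflTransGen.cases_head hq' with rfl | ⟨q'', h, -⟩
    · exact hq
    · exact h.elim
  · exact fun h => ⟨_, Relation.ReflTransGen.refl, h⟩

/-- Without ε-transitions, a jump and the following letter are a single step. -/
theorem mem_toNBA_Δ_reachState (φ : LTL Ap) (w : ℕ → Set Ap) (n : ℕ) (q : φ.ldba.Q) :
    q ∈ φ.ldba.toNBA.Δ (φ.inInitial (φ.reachState w n)) (w n) ↔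
      q = φ.inInitial (φ.reachState w (n + 1)) ∨
      ∃ X Y, q = φ.inAccepting (φ.jumpIndex w n X Y)
        ((φ.jumpDBA (φ.jumpIndex w n X Y)).run (wordSuffix w n) 1) := by
  constructor
  · rintro ⟨q', hq', hq⟩
    rcases Relation.ReflTransGen.cases_head hq' with rfl | ⟨q'', ⟨X, Y, rfl⟩, hq''⟩
    · exact Or.inl hq
    · obtain rfl : _ = q' := (Relation.ReflTransGen.cases_head hq'').resolve_right
        fun ⟨_, h, _⟩ => h
      exact Or.inr ⟨X, Y, hq⟩
  · rintro (rfl | ⟨X, Y, rfl⟩)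
    · exact ⟨_, Relation.ReflTransGen.refl, rfl⟩
    · exact ⟨_, Relation.ReflTransGen.single ⟨X, Y, rfl⟩, rfl⟩

theorem exists_jump_of_toNBA_run {φ : LTL Ap} {w : ℕ → Set Ap} {r : ℕ → φ.ldba.Q}
    (h0 : r 0 ∈ φ.ldba.init) (hstep : ∀ n, r (n + 1) ∈ φ.ldba.toNBA.Δ (r n) (w n))
    (hacc : BuchiAccepting φ.ldba.acc r) :
    ∃ n X Y, ∀ k ≥ 1, r (n + k) = φ.inAccepting (φ.jumpIndex w n X Y)
      ((φ.jumpDBA (φ.jumpIndex w n X Y)).run (wordSuffix w n) k) := by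
  obtain ⟨n, hinit, i, s, hs⟩ := exists_first_inAccepting h0 hacc
  have hbefore : ∀ m ≤ n, r m = φ.inInitial (φ.reachState w m) := by
    intro m
    induction m with
    | zero => exact fun _ => h0
    | succ m ih =>
      intro hm
      have hr := hstep m
      rw [ih (by omega), mem_toNBA_Δ_reachState] at hr
      refine hr.resolve_right ?_
      rintro ⟨X, Y, hXY⟩
      obtain ⟨c, hc⟩ := hinit (m + 1) hm
      exact φ.inInitial_ne_inAccepting _ _ _ (hc.symm.trans hXY)
  have hr := hstep n
  rw [hbefore n le_rfl, mem_toNBA_Δ_reachState] at hr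
  obtain ⟨X, Y, hXY⟩ := hr.resolve_left fun h =>
    φ.inInitial_ne_inAccepting _ _ _ (h.symm.trans hs)
  refine ⟨n, X, Y, fun k hk => ?_⟩
  induction k, hk using Nat.le_induction with
  | base => exact hXY
  | succ k _ ih =>
    have hr := hstep (n + k)
    rw [ih] at hr
    exact (Set.ext_iff.1 (φ.toNBA_Δ_inAccepting _ _ _) _).1 hr

/-- The form of `sat_iff_exists_advice` that matches the runs of the automaton. -/
theorem sat_iff_exists_jump (φ : LTL Ap) (w : ℕ → Set Ap) :
    φ.Sat w ↔ ∃ n X Y, wordSuffix w n ∈ (φ.jumpDBA (φ.jumpIndex w n X Y)).language := by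
  rw [sat_iff_exists_advice]
  refine exists_congr fun n => ⟨?_, ?_⟩
  · rintro ⟨X, hX, Y, hY, h⟩
    exact ⟨⟨X, hX⟩, ⟨Y, hY⟩, (DBA.mem_language_D (φ.reachState w n).2 hX hY _).2 h⟩
  · rintro ⟨⟨X, hX⟩, ⟨Y, hY⟩, h⟩
    exact ⟨X, hX, Y, hY, (DBA.mem_language_D (φ.reachState w n).2 hX hY _).1 h⟩

theorem ldba_language (φ : LTL Ap) : φ.ldba.language = φ.language := by
  ext w
  change (∃ r p, φ.ldba.IsAcceptingRun w r p) ↔ φ.Sat w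
  rw [sat_iff_exists_jump]
  constructor
  · rintro ⟨r, p, h⟩
    obtain ⟨n, -, X, Y, hafter⟩ := exists_jump_of_isAcceptingRun h
    exact ⟨n, X, Y, (buchiAccepting_iff_of_tail (φ.inAccepting_injective _)
      (φ.inAccepting_mem_acc _) (b := 0) fun k _ => (hafter k).2).1 h.2⟩
  · rintro ⟨n, X, Y, h⟩
    let i : φ.JumpIndex := φ.jumpIndex w n X Y
    let r : ℕ → φ.ldba.Q := fun m => if m ≤ n then φ.inInitial (φ.reachState w m)
      else φ.inAccepting i ((φ.jumpDBA i).run (wordSuffix w n) (m - (n + 1)))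
    have hr₁ : ∀ m ≤ n, r m = φ.inInitial (φ.reachState w m) := fun m hm => if_pos hm
    have hr₂ : ∀ k, r (n + 1 + k) =
        φ.inAccepting i ((φ.jumpDBA i).run (wordSuffix w n) k) := fun k =>
      (if_neg (by omega)).trans (by rw [Nat.add_sub_cancel_left])
    refine ⟨r, fun m => if m ≤ n then m else m - 1, ⟨?_, ?_, ?_, ?_⟩, ?_⟩
    · rw [hr₁ 0 (Nat.zero_le n)]; rfl
    · simp
    · intro m
      rcases lt_trichotomy m n with hm | rfl | hm
      · left
        rw [if_pos hm.le, if_pos (by omega), hr₁ m hm.le, hr₁ (m + 1) hm]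
        exact ⟨rfl, rfl⟩
      · right
        rw [if_pos le_rfl, if_neg (by omega), hr₁ m le_rfl, hr₂ 0]
        exact ⟨rfl, X, Y, rfl⟩
      · left
        obtain ⟨k, rfl⟩ := Nat.exists_eq_add_of_le (Nat.succ_le_of_lt hm)
        rw [if_neg (by omega), if_neg (by omega), add_assoc n.succ, hr₂ k, hr₂ (k + 1)]
        refine ⟨by omega, ?_⟩
        rw [show n.succ + k - 1 = n + k by omega]
        rfl
    · exact fun m => ⟨n + 1 + m, by rw [if_neg (by omega)]; omega⟩
    · exact (buchiAccepting_iff_of_tail (φ.inAccepting_injective _)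
        (φ.inAccepting_mem_acc _) (b := 0) fun k _ => hr₂ k).2 h

theorem toNBA_language (φ : LTL Ap) : φ.ldba.toNBA.language = φ.language := by
  ext w
  change (∃ r : ℕ → φ.ldba.Q, r 0 ∈ φ.ldba.init ∧
    (∀ n, r (n + 1) ∈ φ.ldba.toNBA.Δ (r n) (w n)) ∧ BuchiAccepting φ.ldba.acc r) ↔ φ.Sat w
  rw [sat_iff_exists_jump]
  constructor
  · rintro ⟨r, h0, hstep, hacc⟩
    obtain ⟨n, X, Y, hafter⟩ := exists_jump_of_toNBA_run h0 hstep hacc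
    exact ⟨n, X, Y, (buchiAccepting_iff_of_tail (φ.inAccepting_injective _)
      (φ.inAccepting_mem_acc _) hafter).1 hacc⟩
  · rintro ⟨n, X, Y, h⟩
    let i : φ.JumpIndex := φ.jumpIndex w n X Y
    let r : ℕ → φ.ldba.Q := fun m => if m ≤ n then φ.inInitial (φ.reachState w m)
      else φ.inAccepting i ((φ.jumpDBA i).run (wordSuffix w n) (m - n))
    have hr₁ : ∀ m ≤ n, r m = φ.inInitial (φ.reachState w m) := fun m hm => if_pos hm
    have hr₂ : ∀ k ≥ 1, r (n + k) =
        φ.inAccepting i ((φ.jumpDBA i).run (wordSuffix w n) k) := fun k hk =>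
      (if_neg (by omega)).trans (by rw [Nat.add_sub_cancel_left])
    refine ⟨r, ?_, ?_, ?_⟩
    · rw [hr₁ 0 (Nat.zero_le n)]; rfl
    · intro m
      rcases lt_trichotomy m n with hm | rfl | hm
      · rw [hr₁ m hm.le, hr₁ (m + 1) hm, mem_toNBA_Δ_reachState]
        exact Or.inl rfl
      · rw [hr₁ m le_rfl, hr₂ 1 le_rfl, mem_toNBA_Δ_reachState]
        exact Or.inr ⟨X, Y, rfl⟩
      · obtain ⟨k, rfl⟩ := Nat.exists_eq_add_of_le hm.le
        rw [hr₂ k (by omega), add_assoc, hr₂ (k + 1) (by omega), toNBA_Δ_inAccepting]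
        rfl
    · exact (buchiAccepting_iff_of_tail (φ.inAccepting_injective _)
        (φ.inAccepting_mem_acc _) hr₂).2 h

theorem exists_unique_nondet_step {φ : LTL Ap} {w : ℕ → Set Ap} {r : ℕ → φ.ldba.Q}
    {p : ℕ → ℕ} (h : φ.ldba.IsAcceptingRun w r p) :
    ∃ n, p (n + 1) = p n ∧ r n ∈ φ.ldbaInitial ∧ r (n + 1) ∈ φ.ldbaAccepting ∧
      ∀ m, ¬ φ.ldba.IsDetStep w r p m ↔ m = n := by
  obtain ⟨n, hbefore, X, Y, hafter⟩ := exists_jump_of_isAcceptingRun h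
  have hjump : p (n + 1) = p n := (hafter 0).1.trans (hbefore n le_rfl).1.symm
  refine ⟨n, hjump, ⟨_, (hbefore n le_rfl).2⟩, ⟨_, (hafter 0).2⟩, fun m => ⟨fun hm => ?_, ?_⟩⟩
  · by_contra hne
    refine hm ?_
    rcases lt_or_gt_of_ne hne with hlt | hlt
    · obtain ⟨hp, hr⟩ := hbefore m hlt.le
      obtain ⟨hp', hr'⟩ := hbefore (m + 1) hlt
      exact ⟨by omega, by rw [hp, hr, hr', ldba_Δ_reachState]⟩
    · obtain ⟨k, rfl⟩ := Nat.exists_eq_add_of_le (Nat.succ_le_of_lt hlt)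
      obtain ⟨hp, hr⟩ := hafter k
      obtain ⟨hp', hr'⟩ := hafter (k + 1)
      rw [← add_assoc] at hp' hr'
      refine ⟨by simp only [Nat.succ_eq_add_one]; omega, ?_⟩
      simp only [Nat.succ_eq_add_one]
      rw [hp, hr, hr', ldba_Δ_inAccepting]
      rfl
  · rintro rfl ⟨hp, -⟩
    omega

/-! ### The structure and the size of the automaton -/

theorem compl_ldbaInitial (φ : LTL Ap) : φ.ldbaInitialᶜ = φ.ldbaAccepting := by
  ext q
  constructor
  · intro h
    rcases φ.cases_state q with ⟨c, rfl⟩ | ⟨i, s, rfl⟩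
    · exact absurd ⟨c, rfl⟩ h
    · exact ⟨⟨i, s⟩, rfl⟩
  · rintro ⟨s, rfl⟩ ⟨c, hc⟩
    exact Sum.inr_ne_inl hc

theorem ldba_isLimitDeterministicWith (φ : LTL Ap) :
    φ.ldba.IsLimitDeterministicWith φ.ldbaAccepting := by
  refine ⟨?_, ?_, ?_⟩
  · rintro _ ⟨⟨i, s⟩, rfl⟩ ν
    exact ⟨_, ⟨⟨i, _⟩, rfl⟩, φ.ldba_Δ_inAccepting i s ν⟩
  · rintro _ ⟨s, rfl⟩
    rfl
  · rintro _ ⟨s, rfl, -⟩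
    exact ⟨s, rfl⟩

theorem ldba_isDeterministicUpToJumps (φ : LTL Ap) :
    φ.ldba.IsDeterministicUpToJumps φ.ldbaInitial := by
  refine ⟨⟨_, ⟨_, rfl⟩, rfl⟩, ?_, ?_⟩
  · rintro _ ⟨c, rfl⟩ ν
    exact ⟨_, ⟨_, rfl⟩, rfl⟩
  · rintro _ ⟨c, rfl⟩ _ ⟨X, Y, rfl⟩ ⟨c', hc'⟩
    exact Sum.inr_ne_inl hc'

theorem toNBA_isLimitDeterministic (φ : LTL Ap) : φ.ldba.toNBA.IsLimitDeterministic := by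
  refine ⟨φ.ldbaAccepting, ?_, φ.ldba_isLimitDeterministicWith.2.2⟩
  rintro _ ⟨⟨i, s⟩, rfl⟩ ν
  exact ⟨_, ⟨⟨i, _⟩, rfl⟩, φ.toNBA_Δ_inAccepting i s ν⟩

theorem finite_ldbaInitial (φ : LTL Ap) :
    φ.ldbaInitial.Finite ∧ φ.ldbaInitial.ncard ≤ 2 ^ 2 ^ φ.length := by
  obtain ⟨hfin, hcard⟩ := card_Reach_le φ
  have hrange : φ.ldbaInitial = Set.range φ.inInitial := by
    ext q
    exact exists_congr fun c => eq_comm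
  rw [hrange]
  refine ⟨Set.finite_range _, ?_⟩
  rw [← Nat.card_coe_set_eq]
  exact (Finite.card_range_le φ.inInitial).trans hcard

theorem card_ldba_le (φ : LTL Ap) :
    Finite φ.ldba.Q ∧ Nat.card φ.ldba.Q ≤ 2 ^ 2 ^ (7 * φ.length) := by
  classical
  obtain ⟨hfin, hcard⟩ := card_Reach_le φ
  have hsub : ∀ s : Finset (LTL Ap), Finite {X : Finset (LTL Ap) // X ⊆ s} ∧
      Nat.card {X : Finset (LTL Ap) // X ⊆ s} = 2 ^ s.card := fun s => by
    have h : ∀ X, X ∈ s.powerset ↔ X ⊆ s := fun X => Finset.mem_powerset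
    exact ⟨Finite.of_equiv _ (Equiv.subtypeEquivRight h),
      by rw [Nat.subtype_card _ h, Finset.card_powerset]⟩
  have := (hsub φ.muSub).1
  have := (hsub φ.nuSub).1
  have hJ : Finite φ.JumpIndex := inferInstanceAs (Finite (_ × _ × _))
  have hD : ∀ i : φ.JumpIndex, Finite (φ.jumpDBA i).Q ∧
      Nat.card (φ.jumpDBA i).Q ≤ 2 ^ 2 ^ (5 * φ.length) := fun i =>
    DBA.card_D_le i.1.2 i.2.1.2 i.2.2.2
  have hDfin := fun i => (hD i).1
  refine ⟨inferInstanceAs (Finite (φ.Reach ⊕ (Σ i : φ.JumpIndex, (φ.jumpDBA i).Q))), ?_⟩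
  change Nat.card (φ.Reach ⊕ (Σ i : φ.JumpIndex, (φ.jumpDBA i).Q)) ≤ _
  have := Fintype.ofFinite φ.JumpIndex
  have hn1 := length_pos φ
  have hJcard : Nat.card φ.JumpIndex ≤ 2 ^ 2 ^ φ.length * (2 ^ φ.length * 2 ^ φ.length) := by
    change Nat.card (φ.Reach × {X : Finset (LTL Ap) // X ⊆ φ.muSub} ×
      {Y : Finset (LTL Ap) // Y ⊆ φ.nuSub}) ≤ _
    rw [Nat.card_prod, Nat.card_prod, (hsub _).2, (hsub _).2]
    exact Nat.mul_le_mul hcard (Nat.mul_le_mul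
      (Nat.pow_le_pow_right two_pos ((Finset.card_le_card φ.muSub_subset_sf).trans φ.card_sf_le))
      (Nat.pow_le_pow_right two_pos ((Finset.card_le_card φ.nuSub_subset_sf).trans φ.card_sf_le)))
  rw [Nat.card_sum, Nat.card_sigma]
  set n := φ.length
  have hsum : ∑ i : φ.JumpIndex, Nat.card (φ.jumpDBA i).Q ≤
      2 ^ 2 ^ n * (2 ^ n * 2 ^ n) * 2 ^ 2 ^ (5 * n) := by
    refine (Finset.sum_le_card_nsmul _ _ _ fun i _ => (hD i).2).trans ?_
    rw [smul_eq_mul, Finset.card_univ, ← Nat.card_eq_fintype_card]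
    exact Nat.mul_le_mul_right _ hJcard
  have hn : n < 2 ^ n := Nat.lt_two_pow_self
  have h5 : 2 ^ n ≤ 2 ^ (5 * n) := Nat.pow_le_pow_right two_pos (by omega)
  have h7 : 2 ^ (5 * n) * 4 ≤ 2 ^ (7 * n) := by
    rw [show 7 * n = 5 * n + 2 * n by ring, pow_add 2 (5 * n)]
    exact Nat.mul_le_mul_left _ (Nat.pow_le_pow_right (n := 2) (i := 2) two_pos (by omega))
  calc Nat.card φ.Reach + ∑ i : φ.JumpIndex, Nat.card (φ.jumpDBA i).Q
      ≤ 2 ^ 2 ^ n + 2 ^ 2 ^ n * (2 ^ n * 2 ^ n) * 2 ^ 2 ^ (5 * n) := add_le_add hcard hsum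
    _ = 2 ^ 2 ^ n + 2 ^ (2 ^ n + (n + n) + 2 ^ (5 * n)) := by
        rw [← pow_add, ← pow_add, ← pow_add]
    _ ≤ 2 ^ (2 ^ n + (n + n) + 2 ^ (5 * n)) + 2 ^ (2 ^ n + (n + n) + 2 ^ (5 * n)) :=
        Nat.add_le_add_right (Nat.pow_le_pow_right two_pos (by omega)) _
    _ = 2 ^ (2 ^ n + (n + n) + 2 ^ (5 * n) + 1) := by rw [pow_succ, mul_two]
    _ ≤ 2 ^ 2 ^ (7 * n) := Nat.pow_le_pow_right two_pos (by omega)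

end LTL

theorem mainTheorem4 :
    ∃ C : ℕ, ∀ (Ap : Type*) (φ : LTL Ap),
      -- the DBAs `D_{ψ,X,Y}` recognize the required intersections and are small
      (∀ ψ : LTL Ap, PropClass.mk ψ ∈ φ.Reach → ∀ X ⊆ φ.muSub, ∀ Y ⊆ φ.nuSub,
        (DBA.D (PropClass.mk ψ) X Y).language =
            {w | (ψ.evalNu X).Sat w ∧
              (∀ χ ∈ X, (LTL.G (LTL.F (χ.evalMu Y))).Sat w) ∧
              (∀ χ ∈ Y, (LTL.G (χ.evalNu X)).Sat w)} ∧
          Finite (DBA.D (PropClass.mk ψ) X Y).Q ∧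
          Nat.card (DBA.D (PropClass.mk ψ) X Y).Q ≤ 2 ^ 2 ^ (C * φ.length)) ∧
      -- the automaton is limit-deterministic, with a deterministic initial component
      φ.ldbaInitialᶜ = φ.ldbaAccepting ∧
      φ.ldba.IsLimitDeterministicWith φ.ldbaAccepting ∧
      φ.ldba.IsDeterministicUpToJumps φ.ldbaInitial ∧
      -- it recognizes `L(φ)`
      φ.ldba.language = φ.language ∧
      -- the number of states of the initial component and of the whole automaton
      φ.ldbaInitial.Finite ∧ φ.ldbaInitial.ncard ≤ 2 ^ 2 ^ φ.length ∧
      Finite φ.ldba.Q ∧ Nat.card φ.ldba.Q ≤ 2 ^ 2 ^ (C * φ.length) ∧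
      -- every accepting run has exactly one nondeterministic step, which is an ε-jump
      (∀ w r p, φ.ldba.IsAcceptingRun w r p →
        ∃ n, p (n + 1) = p n ∧ r n ∈ φ.ldbaInitial ∧ r (n + 1) ∈ φ.ldbaAccepting ∧
          ∀ m, ¬ φ.ldba.IsDetStep w r p m ↔ m = n) ∧
      -- removing the ε-transitions yields an ε-free limit-deterministic automaton for `L(φ)` on
      -- the same states
      φ.ldba.toNBA.IsLimitDeterministic ∧ φ.ldba.toNBA.language = φ.language := by
  refine ⟨7, fun Ap φ => ⟨fun ψ hψ X hX Y hY => ⟨?_, ?_, ?_⟩, φ.compl_ldbaInitial,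
    φ.ldba_isLimitDeterministicWith, φ.ldba_isDeterministicUpToJumps, φ.ldba_language,
    φ.finite_ldbaInitial.1, φ.finite_ldbaInitial.2, φ.card_ldba_le.1, φ.card_ldba_le.2,
    fun w r p h => LTL.exists_unique_nondet_step h, φ.toNBA_isLimitDeterministic,
    φ.toNBA_language⟩⟩
  · ext w
    exact DBA.mem_language_D hψ hX hY w
  · exact (DBA.card_D_le hψ hX hY).1
  · exact (DBA.card_D_le hψ hX hY).2.trans
      (Nat.pow_le_pow_right two_pos (Nat.pow_le_pow_right two_pos (by omega)))
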